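/- Let $F$ be a finite field and $n\ge 1$. A representation means a complex representation. An irreducible representation of $\mathrm{GL}_n(F)$ is *cuspidal* if it has no nonzero vector fixed by the unipotent radical of a proper parabolic subgroup (for $n=1$ this is no condition). Embed $\mathrm{GL}_k(F)\times\mathrm{GL}_k(F)$ in $\mathrm{GL}_{2k}(F)$ block-diagonally. For characters $\chi_1,\chi_2:F^\times\to\mathbb C^\times$ let $\chi_1\times\chi_2$ also denote the character $(g_1,g_2)\mapsto\chi_1(\det g_1)\chi_2(\det g_2)$ of $\mathrm{GL}_k(F)\times\mathrm{GL}_k(F)$, and write $\pi\otimes\chi$ for $\pi\otimes(\chi\circ\det)$. For a representation $\pi$ of $\mathrm{GL}_{2k}(F)$ put $m(\pi,\chi_1\times\chi_2)=\dim\mathrm{Hom}_{\mathrm{GL}_k(F)\times\mathrm{GL}_k(F)}(\pi,\chi_1\times\chi_2)$. Let $\pi_1,\pi_2$ be irreducible cuspidal representations of $\mathrm{GL}_n(F)$, let $\chi_1,\chi_2$ be characters of $F^\times$, and let $\pi_1\times\pi_2$ be the representation of $\mathrm{GL}_{2n}(F)$ parabolically induced from $\pi_1\otimes\pi_2$ on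 the $(n,n)$ parabolic. Then $\pi_1\times\pi_2$ has a nonzero vector on which $\mathrm{GL}_n(F)\times\mathrm{GL}_n(F)$ operates by $\chi_1\times\chi_2$ if and only if at least one of the following holds: 1. $(\pi_1\otimes\chi_1^{-1})^\vee\cong\pi_2\otimes\chi_2^{-1}$; 2. $n=2m$ is even, and each of $\pi_1$ and $\pi_2$ has a nonzero vector on which $\mathrm{GL}_m(F)\times\mathrm{GL}_m(F)$ operates by $\chi_1\times\chi_2$. Moreover, if $n>1$, the dimension of the space of vectors in $\pi_1\times\pi_2$ on which $\mathrm{GL}_n(F)\times\mathrm{GL}_n(F)$ operates by $\chi_1\times\chi_2$ is $$\delta+m(\pi_1,\chi_1\times\chi_2)\,m(\pi_2,\chi_1\times\chi_2)\ \text{ if } n \text{ is even},\qquad \delta\ \text{ if } n \text{ is odd},$$ where $\delta=1$ if condition (1) holds and $\delta=0$ otherwise. -/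

import Mathlib

open scoped Matrix MatrixGroups

namespace LinearPeriod

section Characters

variable {G V : Type*} [Group G] [AddCommGroup V] [Module ℂ V]

/-- The twist `ρ ⊗ χ` of a representation by a character, realised on the space of `ρ`. -/
def twist (ρ : Representation ℂ G V) (χ : G →* ℂˣ) : Representation ℂ G V where
  toFun g := (χ g : ℂ) • ρ g
  map_one' := by simp
  map_mul' g h := by
    ext v
    simp only [map_mul, Units.val_mul, Module.End.mul_apply, LinearMap.smul_apply, map_smul]
    rw [mul_smul, smul_comm]

/-- The one-dimensional representation on `ℂ` given by a character. -/
def charRep (χ : G →* ℂˣ) : Representation ℂ G ℂ :=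
  twist (Representation.trivial ℂ G ℂ) χ

/-- The space of vectors on which the group operates by the character `χ`. -/
def eigenvectors (ρ : Representation ℂ G V) (χ : G →* ℂˣ) : Submodule ℂ V where
  carrier := {v | ∀ g, ρ g v = (χ g : ℂ) • v}
  add_mem' {v w} hv hw g := by rw [map_add, hv g, hw g, smul_add]
  zero_mem' g := by simp
  smul_mem' c v hv g := by rw [map_smul, hv g, smul_comm]

/-- `m(ρ, χ) = dim Hom_G(ρ, χ)`. -/
noncomputable def mult (ρ : Representation ℂ G V) (χ : G →* ℂˣ) : ℕ :=
  Module.finrank ℂ (Representation.IntertwiningMap ρ (charRep χ))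

end Characters

open Classical in
/-- The Iverson bracket of a proposition: `1` if it holds, `0` otherwise. -/
noncomputable def iverson (p : Prop) : ℕ := if p then 1 else 0

section GeneralLinear

variable {F : Type*} [Field F]

/-- The unipotent radical of the stabiliser of the subspace `W` in `GL_n(F)`: the elements acting
trivially on `W` and on `F^n / W`. -/
def unipotentRadical {ι : Type*} [Fintype ι] [DecidableEq ι] (W : Submodule F (ι → F)) :
    Subgroup (GL ι F) where
  carrier := {g | (∀ w ∈ W, g.1 *ᵥ w = w) ∧ ∀ v, g.1 *ᵥ v - v ∈ W}
  one_mem' := by simp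
  mul_mem' {a b} ha hb := by
    refine ⟨fun w hw => ?_, fun v => ?_⟩
    · rw [Units.val_mul, ← Matrix.mulVec_mulVec, hb.1 w hw, ha.1 w hw]
    · rw [Units.val_mul, ← Matrix.mulVec_mulVec]
      simpa using W.add_mem (ha.2 (b.1 *ᵥ v)) (hb.2 v)
  inv_mem' {a} ha := by
    have key : ∀ v, (a⁻¹).1 *ᵥ (a.1 *ᵥ v) = v := fun v => by
      rw [Matrix.mulVec_mulVec, ← Units.val_mul, inv_mul_cancel, Units.val_one, Matrix.one_mulVec]
    have key' : ∀ v, a.1 *ᵥ ((a⁻¹).1 *ᵥ v) = v := fun v => by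
      rw [Matrix.mulVec_mulVec, ← Units.val_mul, mul_inv_cancel, Units.val_one, Matrix.one_mulVec]
    refine ⟨fun w hw => ?_, fun v => ?_⟩
    · have h := key w
      rwa [ha.1 w hw] at h
    · have h := W.neg_mem (ha.2 ((a⁻¹).1 *ᵥ v))
      rwa [key', neg_sub] at h

/-- An irreducible cuspidal representation of `GL_n(F)`: no nonzero vector is fixed by the unipotent
radical of a proper parabolic subgroup. It suffices to consider the maximal proper parabolics, which
are the stabilisers of the subspaces `W` with `0 ≠ W ≠ F^n`, since the unipotent radical of the
stabiliser of a flag contains that of the stabiliser of each member of the flag. -/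
structure IsCuspidal {n : ℕ} {V : Type*} [AddCommGroup V] [Module ℂ V]
    (π : Representation ℂ (GL (Fin n) F) V) : Prop where
  irreducible : π.IsIrreducible
  cuspidal : ∀ W : Submodule F (Fin n → F), W ≠ ⊥ → W ≠ ⊤ →
    ∀ v : V, (∀ u ∈ unipotentRadical W, π u v = v) → v = 0

/-- The character `χ ∘ det` of `GL_n(F)`. -/
def detChar (n : ℕ) (χ : Fˣ →* ℂˣ) : GL (Fin n) F →* ℂˣ :=
  χ.comp Matrix.GeneralLinearGroup.det

/-- The character `χ₁ × χ₂ : (g₁, g₂) ↦ χ₁(det g₁) χ₂(det g₂)` of `GL_n(F) × GL_n(F)`. -/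
def pairChar (n : ℕ) (χ₁ χ₂ : Fˣ →* ℂˣ) : GL (Fin n) F × GL (Fin n) F →* ℂˣ :=
  (detChar n χ₁).coprod (detChar n χ₂)

/-- The block diagonal embedding `GL_n(F) × GL_n(F) → GL_{2n}(F)`. The `2n` rows and columns are
indexed by `Fin n ⊕ Fin n`, the first `n` of them by the left summand. -/
def blockDiag (n : ℕ) : GL (Fin n) F × GL (Fin n) F →* GL (Fin n ⊕ Fin n) F where
  toFun g :=
    { val := Matrix.fromBlocks g.1.1 0 0 g.2.1
      inv := Matrix.fromBlocks (g.1⁻¹).1 0 0 (g.2⁻¹).1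
      val_inv := by
        simp only [Matrix.fromBlocks_multiply, ← Units.val_mul]
        simp
      inv_val := by
        simp only [Matrix.fromBlocks_multiply, ← Units.val_mul]
        simp }
  map_one' := by ext1; simp
  map_mul' g h := by ext1; simp [Matrix.fromBlocks_multiply]

/-- For `n = 2m`, the block diagonal embedding `GL_m(F) × GL_m(F) → GL_n(F)`, the first factor
acting on the first `m` coordinates and the second one on the last `m` coordinates. -/
def blockDiagHalf {m n : ℕ} (h : n = 2 * m) : GL (Fin m) F × GL (Fin m) F →* GL (Fin n) F :=
  (Units.map (Matrix.reindexAlgEquiv F F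
    (finSumFinEquiv.trans (finCongr (by omega : m + m = n)))).toMonoidHom).comp (blockDiag m)

/-- The `(n,n)` parabolic subgroup of `GL_{2n}(F)`: the block upper triangular matrices. -/
def parabolic (F : Type*) [Field F] (n : ℕ) : Subgroup (GL (Fin n ⊕ Fin n) F) where
  carrier := {g | g.1.toBlocks₂₁ = 0}
  one_mem' := by
    ext i j
    simp [Matrix.toBlocks₂₁]
  mul_mem' {a b} ha hb := by
    have ha : a.1.toBlocks₂₁ = 0 := ha
    have hb : b.1.toBlocks₂₁ = 0 := hb
    change (a.1 * b.1).toBlocks₂₁ = 0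
    rw [← Matrix.fromBlocks_toBlocks a.1, ← Matrix.fromBlocks_toBlocks b.1,
      Matrix.fromBlocks_multiply, Matrix.toBlocks_fromBlocks₂₁, ha, hb]
    simp
  inv_mem' {a} ha := by
    have ha : a.1.toBlocks₂₁ = 0 := ha
    have h : (a⁻¹).1 * a.1 = 1 := by rw [← Units.val_mul, inv_mul_cancel, Units.val_one]
    rw [← Matrix.fromBlocks_toBlocks a.1, ← Matrix.fromBlocks_toBlocks (a⁻¹).1,
      Matrix.fromBlocks_multiply, ha, ← Matrix.fromBlocks_one, Matrix.fromBlocks_inj] at h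
    simp only [mul_zero, add_zero] at h
    have h' : a.1.toBlocks₁₁ * (a⁻¹).1.toBlocks₁₁ = 1 := mul_eq_one_comm.mp h.1
    change (a⁻¹).1.toBlocks₂₁ = 0
    calc (a⁻¹).1.toBlocks₂₁
        = (a⁻¹).1.toBlocks₂₁ * (a.1.toBlocks₁₁ * (a⁻¹).1.toBlocks₁₁) := by rw [h', mul_one]
      _ = 0 := by rw [← mul_assoc, h.2.2.1, zero_mul]

theorem parabolic_blocks_mul {n : ℕ} (p q : parabolic F n) :
    (p * q).1.1.toBlocks₁₁ = p.1.1.toBlocks₁₁ * q.1.1.toBlocks₁₁ ∧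
      (p * q).1.1.toBlocks₂₂ = p.1.1.toBlocks₂₂ * q.1.1.toBlocks₂₂ := by
  have hp : p.1.1.toBlocks₂₁ = 0 := p.2
  have hq : q.1.1.toBlocks₂₁ = 0 := q.2
  have h : (p * q).1.1 = p.1.1 * q.1.1 := rfl
  rw [← Matrix.fromBlocks_toBlocks p.1.1, ← Matrix.fromBlocks_toBlocks q.1.1,
    Matrix.fromBlocks_multiply, hp, hq] at h
  rw [h]
  simp

theorem parabolic_blocks_one {n : ℕ} :
    (1 : parabolic F n).1.1.toBlocks₁₁ = 1 ∧ (1 : parabolic F n).1.1.toBlocks₂₂ = 1 := by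
  have h : (1 : parabolic F n).1.1 = Matrix.fromBlocks 1 0 0 1 := Matrix.fromBlocks_one.symm
  rw [h]
  exact ⟨Matrix.toBlocks_fromBlocks₁₁ _ _ _ _, Matrix.toBlocks_fromBlocks₂₂ _ _ _ _⟩

/-- The projection of the parabolic subgroup onto its Levi quotient `GL_n(F) × GL_n(F)`, given by
the two diagonal blocks. -/
def leviQuotient (F : Type*) [Field F] (n : ℕ) :
    parabolic F n →* GL (Fin n) F × GL (Fin n) F where
  toFun p :=
    ({ val := p.1.1.toBlocks₁₁
       inv := (p⁻¹).1.1.toBlocks₁₁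
       val_inv := by
        rw [← (parabolic_blocks_mul _ _).1, mul_inv_cancel, parabolic_blocks_one.1]
       inv_val := by
        rw [← (parabolic_blocks_mul _ _).1, inv_mul_cancel, parabolic_blocks_one.1] },
     { val := p.1.1.toBlocks₂₂
       inv := (p⁻¹).1.1.toBlocks₂₂
       val_inv := by
        rw [← (parabolic_blocks_mul _ _).2, mul_inv_cancel, parabolic_blocks_one.2]
       inv_val := by
        rw [← (parabolic_blocks_mul _ _).2, inv_mul_cancel, parabolic_blocks_one.2] })
  map_one' := by
    refine Prod.ext (Units.ext ?_) (Units.ext ?_)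
    · exact parabolic_blocks_one.1
    · exact parabolic_blocks_one.2
  map_mul' p q := by
    refine Prod.ext (Units.ext ?_) (Units.ext ?_)
    · exact (parabolic_blocks_mul p q).1
    · exact (parabolic_blocks_mul p q).2

/-- The external tensor product `π₁ ⊠ π₂` of `GL_n(F) × GL_n(F)`, inflated to the parabolic. -/
noncomputable def inflation {n : ℕ} {V₁ V₂ : Type*} [AddCommGroup V₁] [Module ℂ V₁]
    [AddCommGroup V₂] [Module ℂ V₂] (π₁ : Representation ℂ (GL (Fin n) F) V₁)
    (π₂ : Representation ℂ (GL (Fin n) F) V₂) :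
    Representation ℂ (parabolic F n) (TensorProduct ℂ V₁ V₂) :=
  Representation.tprod (π₁.comp ((MonoidHom.fst _ _).comp (leviQuotient F n)))
    (π₂.comp ((MonoidHom.snd _ _).comp (leviQuotient F n)))

/-- The representation `π₁ × π₂` of `GL_{2n}(F)` parabolically induced from the `(n,n)` parabolic
`P`: the functions `f : GL_{2n}(F) → V₁ ⊗ V₂` with `f (p g) = (π₁ ⊠ π₂)(p) (f g)` for `p ∈ P`,
with `GL_{2n}(F)` acting by right translation. -/
noncomputable def parInd {n : ℕ} {V₁ V₂ : Type*} [AddCommGroup V₁] [Module ℂ V₁]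
    [AddCommGroup V₂] [Module ℂ V₂] (π₁ : Representation ℂ (GL (Fin n) F) V₁)
    (π₂ : Representation ℂ (GL (Fin n) F) V₂) :
    Representation ℂ (GL (Fin n ⊕ Fin n) F)
      (Representation.coindV (parabolic F n).subtype (inflation π₁ π₂)) :=
  Representation.coind (parabolic F n).subtype (inflation π₁ π₂)

/-- The space of vectors in `π₁ × π₂` on which `GL_n(F) × GL_n(F)` operates by `χ₁ × χ₂`. -/
noncomputable def indEigenvectors {n : ℕ} {V₁ V₂ : Type*} [AddCommGroup V₁] [Module ℂ V₁]
    [AddCommGroup V₂] [Module ℂ V₂] (π₁ : Representation ℂ (GL (Fin n) F) V₁)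
    (π₂ : Representation ℂ (GL (Fin n) F) V₂) (χ₁ χ₂ : Fˣ →* ℂˣ) :
    Submodule ℂ (Representation.coindV (parabolic F n).subtype (inflation π₁ π₂)) :=
  eigenvectors ((parInd π₁ π₂).comp (blockDiag n)) (pairChar n χ₁ χ₂)

/-- For `n = 2m`, the space of vectors in a representation `π` of `GL_n(F)` on which
`GL_m(F) × GL_m(F)` operates by `χ₁ × χ₂`. -/
def halfEigenvectors {m n : ℕ} (h : n = 2 * m) {V : Type*} [AddCommGroup V] [Module ℂ V]
    (π : Representation ℂ (GL (Fin n) F) V) (χ₁ χ₂ : Fˣ →* ℂˣ) : Submodule ℂ V :=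
  eigenvectors (π.comp (blockDiagHalf h)) (pairChar m χ₁ χ₂)

/-- For `n = 2m`, the multiplicity `m(π, χ₁ × χ₂)`, the dimension of
`Hom_{GL_m(F) × GL_m(F)}(π, χ₁ × χ₂)`. -/
noncomputable def halfMult {m n : ℕ} (h : n = 2 * m) {V : Type*} [AddCommGroup V] [Module ℂ V]
    (π : Representation ℂ (GL (Fin n) F) V) (χ₁ χ₂ : Fˣ →* ℂˣ) : ℕ :=
  mult (π.comp (blockDiagHalf h)) (pairChar m χ₁ χ₂)

/-- The condition `(π₁ ⊗ χ₁⁻¹)^∨ ≅ π₂ ⊗ χ₂⁻¹`. -/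
def DualTwist {n : ℕ} {V₁ V₂ : Type*} [AddCommGroup V₁] [Module ℂ V₁]
    [AddCommGroup V₂] [Module ℂ V₂] (π₁ : Representation ℂ (GL (Fin n) F) V₁)
    (π₂ : Representation ℂ (GL (Fin n) F) V₂) (χ₁ χ₂ : Fˣ →* ℂˣ) : Prop :=
  Nonempty (Representation.Equiv (Representation.dual (twist π₁ (detChar n χ₁⁻¹)))
    (twist π₂ (detChar n χ₂⁻¹)))

end GeneralLinear

end LinearPeriod

set_option linter.unusedSectionVars false

namespace LinearPeriod

section Transvections

variable {F : Type*} [Field F] {ι : Type*} [Fintype ι] [DecidableEq ι]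

/-- The transvection `1 + w ⊗ l`. -/
def transvec (w l : ι → F) (h : l ⬝ᵥ w = 0) : GL ι F where
  val := 1 + Matrix.vecMulVec w l
  inv := 1 - Matrix.vecMulVec w l
  val_inv := by
    have : Matrix.vecMulVec w l * Matrix.vecMulVec w l = 0 := by
      rw [Matrix.vecMulVec_mul_vecMulVec, h, zero_smul, Matrix.vecMulVec_zero]
    rw [mul_sub, mul_one, add_mul, one_mul, this]; simp
  inv_val := by
    have : Matrix.vecMulVec w l * Matrix.vecMulVec w l = 0 := by
      rw [Matrix.vecMulVec_mul_vecMulVec, h, zero_smul, Matrix.vecMulVec_zero]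
    rw [sub_mul, one_mul, mul_add, mul_one, this]; simp

theorem transvec_val (w l : ι → F) (h : l ⬝ᵥ w = 0) :
    (transvec w l h).1 = 1 + Matrix.vecMulVec w l := rfl

theorem vecMulVec_mulVec_eq (w l x : ι → F) : Matrix.vecMulVec w l *ᵥ x = (l ⬝ᵥ x) • w := by
  rw [Matrix.vecMulVec_mulVec]; ext i; simp [mul_comm]

theorem transvec_mulVec (w l : ι → F) (h : l ⬝ᵥ w = 0) (x : ι → F) :
    (transvec w l h).1 *ᵥ x = x + (l ⬝ᵥ x) • w := by
  rw [transvec_val, Matrix.add_mulVec, Matrix.one_mulVec, vecMulVec_mulVec_eq]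

theorem transvec_mul (w w' l : ι → F) (h : l ⬝ᵥ w = 0) (h' : l ⬝ᵥ w' = 0) :
    transvec w l h * transvec w' l h' =
      transvec (w + w') l (by rw [dotProduct_add, h, h', add_zero]) := by
  ext1
  rw [Units.val_mul, transvec_val, transvec_val, transvec_val, mul_add, add_mul, add_mul,
    Matrix.vecMulVec_mul_vecMulVec, h', zero_smul, Matrix.vecMulVec_zero, Matrix.add_vecMulVec]
  simp [add_assoc]

theorem mul_transvec (g : GL ι F) (w l : ι → F) (h : l ⬝ᵥ w = 0) (hg : l ᵥ* g.1 = l)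
    (h' : l ⬝ᵥ (g.1 *ᵥ w) = 0) :
    g * transvec w l h = transvec (g.1 *ᵥ w) l h' * g := by
  ext1
  rw [Units.val_mul, Units.val_mul, transvec_val, transvec_val, mul_add, add_mul,
    Matrix.mul_vecMulVec, Matrix.vecMulVec_mul, hg]
  simp

variable {V : Type*} [AddCommGroup V] [Module ℂ V] (π : Representation ℂ (GL ι F) V)
  (ψ : AddChar F ℂ) {W : Submodule F (ι → F)} [Fintype W] {l : ι → F} (hl : ∀ w ∈ W, l ⬝ᵥ w = 0)

/-- The (unnormalised) component of `v` on which the transvections `1 + w ⊗ l` with `w ∈ W` operate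
by the character `w ↦ ψ (l' ⬝ᵥ w)`. -/
noncomputable def fourierCoeff (l' : ι → F) (v : V) : V :=
  ∑ w : W, ψ (-(l' ⬝ᵥ w.1)) • π (transvec w.1 l (hl w w.2)) v

theorem transvec_fourierCoeff (l' : ι → F) (v : V) (w : ι → F) (hw : w ∈ W) :
    π (transvec w l (hl w hw)) (fourierCoeff π ψ hl l' v) =
      ψ (l' ⬝ᵥ w) • fourierCoeff π ψ hl l' v := by
  rw [fourierCoeff, map_sum, Finset.smul_sum,
    ← Equiv.sum_comp (Equiv.addLeft (⟨w, hw⟩ : W))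
      (fun x : W => ψ (l' ⬝ᵥ w) • ψ (-(l' ⬝ᵥ x.1)) • π (transvec x.1 l (hl x x.2)) v)]
  refine Finset.sum_congr rfl fun x _ => ?_
  rw [map_smul, ← Module.End.mul_apply, ← map_mul, transvec_mul _ _ _ _ (hl x x.2), smul_smul,
    ← AddChar.map_add_eq_mul]
  simp only [Equiv.coe_addLeft, Submodule.coe_add, dotProduct_add]
  congr 2
  ring

theorem map_fourierCoeff (l' : ι → F) (v : V) (g : GL ι F) (hgW : ∀ w ∈ W, g.1 *ᵥ w ∈ W)
    (hgl : l ᵥ* g.1 = l) (hgl' : ∀ w ∈ W, l' ⬝ᵥ (g.1 *ᵥ w) = l' ⬝ᵥ w) (hv : π g v = v) :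
    π g (fourierCoeff π ψ hl l' v) = fourierCoeff π ψ hl l' v := by
  have hinj : Function.Injective (fun w : W => (⟨g.1 *ᵥ w.1, hgW w w.2⟩ : W)) := by
    intro a b hab
    have : g.1 *ᵥ a.1 = g.1 *ᵥ b.1 := congrArg Subtype.val hab
    have h2 := congrArg (fun x => (g⁻¹).1 *ᵥ x) this
    simp only [Matrix.mulVec_mulVec, ← Units.val_mul, inv_mul_cancel, Units.val_one,
      Matrix.one_mulVec] at h2
    exact Subtype.ext h2
  have hbij := (Fintype.bijective_iff_injective_and_card _).2 ⟨hinj, rfl⟩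
  rw [fourierCoeff, map_sum,
    ← Equiv.sum_comp (Equiv.ofBijective _ hbij)
      (fun x : W => ψ (-(l' ⬝ᵥ x.1)) • π (transvec x.1 l (hl x x.2)) v)]
  refine Finset.sum_congr rfl fun x _ => ?_
  have h1 : l ⬝ᵥ (g.1 *ᵥ x.1) = 0 := hl _ (hgW x x.2)
  rw [map_smul, ← Module.End.mul_apply, ← map_mul, mul_transvec g x.1 l _ hgl h1, map_mul,
    Module.End.mul_apply, hv]
  simp only [Equiv.ofBijective_apply, hgl' x x.2]

theorem sum_addChar_dotProduct [Fintype F] [DecidableEq F] (hψ : ψ 1 ≠ 1) (x : ι → F) :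
    ∑ μ : ι → F, ψ (-(μ ⬝ᵥ x)) = if x = 0 then (Fintype.card (ι → F) : ℂ) else 0 := by
  split_ifs with hx
  · simp [hx]
  · obtain ⟨i, hi⟩ := Function.ne_iff.1 hx
    let χ : AddChar (ι → F) ℂ :=
      { toFun := fun μ => ψ (-(μ ⬝ᵥ x))
        map_zero_eq_one' := by simp
        map_add_eq_mul' := fun a b => by rw [add_dotProduct, neg_add, AddChar.map_add_eq_mul] }
    have : χ ≠ 1 := by
      intro h
      have h2 := DFunLike.congr_fun h (Pi.single i (-(x i)⁻¹))
      change ψ (-(Pi.single i (-(x i)⁻¹) ⬝ᵥ x)) = 1 at h2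
      rw [single_dotProduct, neg_mul, neg_neg, inv_mul_cancel₀ hi] at h2
      exact hψ h2
    exact AddChar.sum_eq_zero_of_ne_one this

/-- If `v ≠ 0` is fixed by the `1 + w ⊗ l` with `w ∈ W` in the fixed space of `E`, then it has a
nonzero Fourier coefficient at a form `l'` vanishing on this fixed space. -/
theorem exists_fourierCoeff_ne_zero [Finite F] (hψ : ψ 1 ≠ 1) (E : Matrix ι ι F) {v : V}
    (hv0 : v ≠ 0) (hv : ∀ w (hw : w ∈ W), E *ᵥ w = w → π (transvec w l (hl w hw)) v = v) :
    ∃ μ : ι → F, fourierCoeff π ψ hl (μ ᵥ* (1 - E)) v ≠ 0 := by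
  classical
  have := Fintype.ofFinite F
  by_contra! hcon
  have h1 : ∑ μ : ι → F, fourierCoeff π ψ hl (μ ᵥ* (1 - E)) v = 0 :=
    Finset.sum_eq_zero fun μ _ => hcon μ
  simp only [fourierCoeff] at h1
  rw [Finset.sum_comm] at h1
  have h2 : ∀ w : W, ∑ μ : ι → F, ψ (-((μ ᵥ* (1 - E)) ⬝ᵥ w.1)) • π (transvec w.1 l (hl w w.2)) v =
      (if E *ᵥ w.1 = w.1 then (Fintype.card (ι → F) : ℂ) else 0) • v := by
    intro w
    simp only [← Matrix.dotProduct_mulVec]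
    rw [← Finset.sum_smul, sum_addChar_dotProduct ψ hψ]
    have : (1 - E) *ᵥ w.1 = 0 ↔ E *ᵥ w.1 = w.1 := by
      rw [Matrix.sub_mulVec, Matrix.one_mulVec, sub_eq_zero, eq_comm]
    simp only [this]
    split_ifs with h
    · rw [hv _ w.2 h]
    · simp
  rw [Finset.sum_congr rfl fun w _ => h2 w, ← Finset.sum_smul, smul_eq_zero] at h1
  have h3 := h1.resolve_right hv0
  rw [← Finset.sum_filter, Finset.sum_const, nsmul_eq_mul, mul_eq_zero] at h3
  rcases h3 with h3 | h3
  · rw [Nat.cast_eq_zero, Finset.card_eq_zero, Finset.filter_eq_empty_iff] at h3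
    exact h3 (Finset.mem_univ (0 : W)) (by simp)
  · exact Fintype.card_ne_zero (Nat.cast_eq_zero.1 h3)

end Transvections

section LinearAlgebra

variable {F : Type*} [Field F] {ι : Type*} [Fintype ι] [DecidableEq ι]

/-- The space of vectors fixed by a matrix. -/
def fixedSpace (E : Matrix ι ι F) : Submodule F (ι → F) where
  carrier := {x | E *ᵥ x = x}
  add_mem' {x y} hx hy := by
    change E *ᵥ (x + y) = x + y
    rw [Matrix.mulVec_add, hx, hy]
  zero_mem' := Matrix.mulVec_zero E
  smul_mem' c x hx := by
    change E *ᵥ (c • x) = c • x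
    rw [Matrix.mulVec_smul, hx]

theorem mem_fixedSpace {E : Matrix ι ι F} {x : ι → F} : x ∈ fixedSpace E ↔ E *ᵥ x = x := Iff.rfl

/-- The hyperplane defined by a linear form. -/
def formKer (l : ι → F) : Submodule F (ι → F) where
  carrier := {x | l ⬝ᵥ x = 0}
  add_mem' {x y} hx hy := by
    change l ⬝ᵥ (x + y) = 0
    rw [dotProduct_add, hx, hy, add_zero]
  zero_mem' := dotProduct_zero l
  smul_mem' c x hx := by
    change l ⬝ᵥ (c • x) = 0
    rw [dotProduct_smul, hx, smul_zero]

theorem mem_formKer {l x : ι → F} : x ∈ formKer l ↔ l ⬝ᵥ x = 0 := Iff.rfl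

theorem finrank_inf_formKer {X : Submodule F (ι → F)} {l : ι → F} (h : ∃ x ∈ X, l ⬝ᵥ x = 1) :
    Module.finrank F (X ⊓ formKer l : Submodule F (ι → F)) + 1 = Module.finrank F X := by
  obtain ⟨x, hx, hlx⟩ := h
  let f : X →ₗ[F] F := (dotProductBilin F F l).comp X.subtype
  have hf : ∀ y : X, f y = l ⬝ᵥ y.1 := fun _ => rfl
  have hsurj : LinearMap.range f = ⊤ := by
    rw [LinearMap.range_eq_top]
    intro c
    refine ⟨c • ⟨x, hx⟩, ?_⟩
    rw [hf]
    simp [hlx]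
  have hker : (LinearMap.ker f).map X.subtype = X ⊓ formKer l := by
    ext y
    simp only [Submodule.mem_map, LinearMap.mem_ker, hf, Submodule.mem_inf, mem_formKer]
    constructor
    · rintro ⟨z, hz, rfl⟩
      exact ⟨z.2, hz⟩
    · rintro ⟨h1, h2⟩
      exact ⟨⟨y, h1⟩, h2, rfl⟩
  have h3 := LinearMap.finrank_range_add_finrank_ker f
  rw [hsurj, finrank_top, Module.finrank_self] at h3
  rw [← hker, Submodule.finrank_map_subtype_eq]
  omega

end LinearAlgebra

section CuspidalPeriods

variable {F : Type*} [Field F] {n : ℕ} {V : Type*} [AddCommGroup V] [Module ℂ V]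
  {π : Representation ℂ (GL (Fin n) F) V}

/-- The vector `v` is fixed by the transvections of the fixed space of `E` along vectors of `W`. -/
def FixedByTransvections (π : Representation ℂ (GL (Fin n) F) V) (E : Matrix (Fin n) (Fin n) F)
    (W : Submodule F (Fin n → F)) (v : V) : Prop :=
  ∀ w ∈ W, ∀ (μ : Fin n → F) (h : μ ⬝ᵥ w = 0), E *ᵥ w = w → μ ᵥ* E = μ →
    π (transvec w μ h) v = v

/-- A nonzero vector which is fixed by the transvections of the two eigenspaces of the idempotent
`E` along `W`, and by the elements which are trivial on `W'` and on `F^n / W`, where `W` is the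
kernel in `W'` of a linear form `l` vanishing on the fixed space of `1 - E`. -/
structure PeriodVector (π : Representation ℂ (GL (Fin n) F) V) (E : Matrix (Fin n) (Fin n) F)
    (W W' : Submodule F (Fin n → F)) (l : Fin n → F) (v : V) : Prop where
  inf_eq : W = W' ⊓ formKer l
  exists_eq_one : ∃ w ∈ W', l ⬝ᵥ w = 1
  mulVec_mem : ∀ w ∈ W, E *ᵥ w ∈ W
  vecMul_eq : l ᵥ* E = l
  ne_zero : v ≠ 0
  fixed : ∀ g : GL (Fin n) F, (∀ w ∈ W', g.1 *ᵥ w = w) → (∀ x, g.1 *ᵥ x - x ∈ W) → π g v = v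
  fixed_left : FixedByTransvections π E W v
  fixed_right : FixedByTransvections π (1 - E) W v

theorem vecMul_one_sub_eq_zero {E : Matrix (Fin n) (Fin n) F} {l : Fin n → F} (h : l ᵥ* E = l) :
    l ᵥ* (1 - E) = 0 := by
  rw [Matrix.vecMul_sub, Matrix.vecMul_one, h, sub_self]

theorem dotProduct_eq_zero_of_mem_fixedSpace {E : Matrix (Fin n) (Fin n) F} {l : Fin n → F}
    (h : l ᵥ* E = l) {x : Fin n → F} (hx : x ∈ fixedSpace (1 - E)) : l ⬝ᵥ x = 0 := by
  rw [← mem_fixedSpace.1 hx, Matrix.dotProduct_mulVec, vecMul_one_sub_eq_zero h, zero_dotProduct]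

theorem fixedByTransvections_fourierCoeff {ψ : AddChar F ℂ} {W : Submodule F (Fin n → F)}
    [Fintype W] {l l' : Fin n → F} (hl : ∀ w ∈ W, l ⬝ᵥ w = 0) {E : Matrix (Fin n) (Fin n) F}
    {v : V} (hv : FixedByTransvections π E W v) :
    FixedByTransvections π E (W ⊓ formKer l') (fourierCoeff π ψ hl l' v) := by
  intro w hw μ h hE hμ
  refine map_fourierCoeff π ψ hl l' v _ ?_ ?_ ?_ (hv w hw.1 μ h hE hμ)
  · intro x hx
    rw [transvec_mulVec]
    exact W.add_mem hx (W.smul_mem _ hw.1)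
  · rw [transvec_val, Matrix.vecMul_add, Matrix.vecMul_one, Matrix.vecMul_vecMulVec, hl w hw.1,
      zero_smul, add_zero]
  · intro x hx
    rw [transvec_mulVec, dotProduct_add, dotProduct_smul, mem_formKer.1 hw.2, smul_zero, add_zero]

variable {E : Matrix (Fin n) (Fin n) F} {W W' : Submodule F (Fin n → F)} {l : Fin n → F} {v : V}

theorem PeriodVector.dotProduct_eq_zero (h : PeriodVector π E W W' l v) :
    ∀ w ∈ W, l ⬝ᵥ w = 0 := by
  intro w hw
  rw [h.inf_eq] at hw
  exact hw.2

theorem PeriodVector.ne_top (h : PeriodVector π E W W' l v) : W ≠ ⊤ := by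
  rintro rfl
  obtain ⟨w, -, hw⟩ := h.exists_eq_one
  rw [h.dotProduct_eq_zero w trivial] at hw
  exact zero_ne_one hw

theorem PeriodVector.fixed_fourierCoeff (h : PeriodVector π E W W' l v) {ψ : AddChar F ℂ}
    [Fintype W] (l' : Fin n → F) (g : GL (Fin n) F) (hg : ∀ w ∈ W, g.1 *ᵥ w = w)
    (hg' : ∀ x, g.1 *ᵥ x - x ∈ W ⊓ formKer l') :
    π g (fourierCoeff π ψ h.dotProduct_eq_zero l' v) =
      fourierCoeff π ψ h.dotProduct_eq_zero l' v := by
  obtain ⟨w₀, hw₀, hlw₀⟩ := h.exists_eq_one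
  have hl := h.dotProduct_eq_zero
  set x := g.1 *ᵥ w₀ - w₀ with hx
  have hxW : x ∈ W := (hg' w₀).1
  have hxl : l' ⬝ᵥ x = 0 := (hg' w₀).2
  have hnx : -x ∈ W := W.neg_mem hxW
  have hfac : g = (g * transvec (-x) l (hl _ hnx)) * transvec x l (hl x hxW) := by
    rw [mul_assoc, transvec_mul]
    have : transvec (-x + x) l (by rw [neg_add_cancel, dotProduct_zero]) = 1 := by
      ext1
      rw [transvec_val, neg_add_cancel, Matrix.zero_vecMulVec, add_zero, Units.val_one]
    rw [this, mul_one]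
  have hact : ∀ y, (g * transvec (-x) l (hl _ hnx)).1 *ᵥ y = g.1 *ᵥ y - (l ⬝ᵥ y) • x := by
    intro y
    rw [Units.val_mul, ← Matrix.mulVec_mulVec, transvec_mulVec, Matrix.mulVec_add,
      Matrix.mulVec_smul, Matrix.mulVec_neg, hg x hxW, smul_neg, sub_eq_add_neg]
  rw [hfac, map_mul, Module.End.mul_apply, transvec_fourierCoeff π ψ hl l' v x hxW, hxl,
    AddChar.map_zero_eq_one, one_smul]
  refine map_fourierCoeff π ψ hl l' v _ ?_ ?_ ?_ (h.fixed _ ?_ ?_)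
  · intro w hw
    rw [hact, hg w hw, hl w hw, zero_smul, sub_zero]
    exact hw
  · have hlg : l ᵥ* g.1 = l := by
      refine dotProduct_eq _ _ fun y => ?_
      rw [← Matrix.dotProduct_mulVec, ← sub_eq_zero, ← dotProduct_sub]
      exact hl _ (hg' y).1
    rw [Units.val_mul, ← Matrix.vecMul_vecMul, hlg, transvec_val, Matrix.vecMul_add,
      Matrix.vecMul_one, Matrix.vecMul_vecMulVec, hl _ hnx, zero_smul, add_zero]
  · intro w hw
    rw [hact, hg w hw, hl w hw, zero_smul, sub_zero]
  · intro w hw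
    have hmem : w - (l ⬝ᵥ w) • w₀ ∈ W := by
      rw [h.inf_eq]
      refine ⟨W'.sub_mem hw (W'.smul_mem _ hw₀), ?_⟩
      rw [SetLike.mem_coe, mem_formKer, dotProduct_sub, dotProduct_smul, hlw₀, smul_eq_mul,
        mul_one, sub_self]
    have h1 := hg _ hmem
    rw [Matrix.mulVec_sub, Matrix.mulVec_smul] at h1
    rw [hact, hx, smul_sub]
    rw [← sub_eq_zero] at h1 ⊢
    rw [← h1]
    abel
  · intro y
    rw [hact, sub_right_comm]
    exact W.sub_mem (hg' y).1 (W.smul_mem _ hxW)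

/-- Taking a suitable Fourier coefficient of a period vector exchanges the two eigenspaces. -/
theorem PeriodVector.exists_next [Finite F] (hπ : IsCuspidal π) (h : PeriodVector π E W W' l v)
    (hE : E * E = E) (hW : W ≠ ⊥) :
    ∃ l' v', PeriodVector π (1 - E) (W ⊓ formKer l') W l' v' := by
  classical
  have := Fintype.ofFinite W
  obtain ⟨ψ, hψ⟩ := AddChar.exists_apply_ne_zero.2 (one_ne_zero (α := F))
  have hl := h.dotProduct_eq_zero
  have hE' : (1 - E) * (1 - E) = 1 - E := by
    rw [mul_sub, mul_one, sub_mul, one_mul, hE, sub_self, sub_zero]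
  obtain ⟨μ, hμ⟩ := exists_fourierCoeff_ne_zero π ψ hl hψ E h.ne_zero
    fun w hw hEw => h.fixed_left w hw l (hl w hw) hEw h.vecMul_eq
  set l' := μ ᵥ* (1 - E) with hl'
  have hl'E : l' ᵥ* (1 - E) = l' := by rw [hl', Matrix.vecMul_vecMul, hE']
  refine ⟨l', _, rfl, ?_, ?_, hl'E, hμ, ?_, ?_, ?_⟩
  · by_contra! hcon
    have hzero : ∀ w ∈ W, l' ⬝ᵥ w = 0 := by
      intro w hw
      by_contra hne
      refine hcon ((l' ⬝ᵥ w)⁻¹ • w) (W.smul_mem _ hw) ?_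
      rw [dotProduct_smul, smul_eq_mul, inv_mul_cancel₀ hne]
    refine hμ (hπ.cuspidal W hW h.ne_top _ fun u hu => ?_)
    exact h.fixed_fourierCoeff l' u hu.1 fun x => ⟨hu.2 x, hzero _ (hu.2 x)⟩
  · intro w hw
    rw [Submodule.mem_inf, mem_formKer, Matrix.dotProduct_mulVec, hl'E]
    refine ⟨?_, hw.2⟩
    rw [Matrix.sub_mulVec, Matrix.one_mulVec]
    exact W.sub_mem hw.1 (h.mulVec_mem w hw.1)
  · exact fun g hg hg' => h.fixed_fourierCoeff l' g hg hg'
  · exact fixedByTransvections_fourierCoeff hl h.fixed_right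
  · rw [sub_sub_cancel]
    exact fixedByTransvections_fourierCoeff hl h.fixed_left

theorem finrank_inf_fixedSpace_inf_formKer {E : Matrix (Fin n) (Fin n) F}
    {W : Submodule F (Fin n → F)} {l : Fin n → F} (hE : E * E = E) (hl : l ᵥ* E = l)
    (hW : ∀ w ∈ W, E *ᵥ w ∈ W) (h : ∃ w ∈ W, l ⬝ᵥ w = 1) :
    Module.finrank F ((W ⊓ formKer l) ⊓ fixedSpace E : Submodule F (Fin n → F)) + 1 =
      Module.finrank F (W ⊓ fixedSpace E : Submodule F (Fin n → F)) := by
  rw [inf_right_comm]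
  refine finrank_inf_formKer ?_
  obtain ⟨w, hw, hlw⟩ := h
  refine ⟨E *ᵥ w, ⟨hW w hw, ?_⟩, ?_⟩
  · change E *ᵥ (E *ᵥ w) = E *ᵥ w
    rw [Matrix.mulVec_mulVec, hE]
  · rw [Matrix.dotProduct_mulVec, hl, hlw]

theorem inf_formKer_inf_fixedSpace_one_sub {E : Matrix (Fin n) (Fin n) F}
    {W : Submodule F (Fin n → F)} {l : Fin n → F} (hl : l ᵥ* E = l) :
    (W ⊓ formKer l) ⊓ fixedSpace (1 - E) = W ⊓ fixedSpace (1 - E) := by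
  ext x
  simp only [Submodule.mem_inf]
  exact ⟨fun h => ⟨h.1.1, h.2⟩,
    fun h => ⟨⟨h.1, dotProduct_eq_zero_of_mem_fixedSpace hl h.2⟩, h.2⟩⟩

theorem PeriodVector.finrank_le [Finite F] (hπ : IsCuspidal π) (d : ℕ) :
    ∀ {E : Matrix (Fin n) (Fin n) F} {W W' : Submodule F (Fin n → F)} {l : Fin n → F} {v : V},
    E * E = E → PeriodVector π E W W' l v → Module.finrank F W = d →
    Module.finrank F (W ⊓ fixedSpace E : Submodule F (Fin n → F)) ≤
      Module.finrank F (W ⊓ fixedSpace (1 - E) : Submodule F (Fin n → F)) ∧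
    Module.finrank F (W ⊓ fixedSpace (1 - E) : Submodule F (Fin n → F)) ≤
      Module.finrank F (W ⊓ fixedSpace E : Submodule F (Fin n → F)) + 1 := by
  induction d with
  | zero =>
    intro E W W' l v _ _ hd
    have hW : W = ⊥ := Submodule.finrank_eq_zero.1 hd
    rw [hW, bot_inf_eq, bot_inf_eq]
    exact ⟨le_rfl, Nat.le_succ _⟩
  | succ d ih =>
    intro E W W' l v hE h hd
    have hW : W ≠ ⊥ := by
      rintro rfl
      rw [finrank_bot] at hd
      omega
    obtain ⟨l', v', h'⟩ := h.exists_next hπ hE hW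
    have hE' : (1 - E) * (1 - E) = 1 - E := by
      rw [mul_sub, mul_one, sub_mul, one_mul, hE, sub_self, sub_zero]
    have hW' : ∀ w ∈ W, (1 - E) *ᵥ w ∈ W := fun w hw => by
      rw [Matrix.sub_mulVec, Matrix.one_mulVec]
      exact W.sub_mem hw (h.mulVec_mem w hw)
    have h1 := finrank_inf_formKer h'.exists_eq_one
    have h2 := ih hE' h' (by omega)
    have h3 := finrank_inf_fixedSpace_inf_formKer hE' h'.vecMul_eq hW' h'.exists_eq_one
    have h4 := inf_formKer_inf_fixedSpace_one_sub (W := W) h'.vecMul_eq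
    rw [sub_sub_cancel] at h2 h4
    rw [h4] at h2
    omega

theorem finrank_fixedSpace_bounds [Finite F] (hπ : IsCuspidal π) {E : Matrix (Fin n) (Fin n) F}
    (hE : E * E = E) (hE0 : E ≠ 0) {v : V} (hv : v ≠ 0) (h₁ : FixedByTransvections π E ⊤ v)
    (h₂ : FixedByTransvections π (1 - E) ⊤ v) :
    Module.finrank F (fixedSpace E) ≤ Module.finrank F (fixedSpace (1 - E)) + 1 ∧
      Module.finrank F (fixedSpace (1 - E)) ≤ Module.finrank F (fixedSpace E) := by
  obtain ⟨i, hi⟩ := Function.ne_iff.1 hE0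
  obtain ⟨j, hij⟩ := Function.ne_iff.1 hi
  change E i j ≠ 0 at hij
  set l : Fin n → F := Pi.single i (E i j)⁻¹ ᵥ* E with hl
  have hlE : l ᵥ* E = l := by rw [hl, Matrix.vecMul_vecMul, hE]
  have hex : ∃ w ∈ (⊤ : Submodule F (Fin n → F)), l ⬝ᵥ w = 1 := by
    refine ⟨Pi.single j 1, trivial, ?_⟩
    rw [dotProduct_single, hl, Matrix.single_vecMul]
    simp [hij]
  have h : PeriodVector π E (⊤ ⊓ formKer l) ⊤ l v := by
    refine ⟨rfl, hex, ?_, hlE, hv, ?_, fun w _ => h₁ w trivial, fun w _ => h₂ w trivial⟩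
    · intro w hw
      refine ⟨trivial, ?_⟩
      rw [SetLike.mem_coe, mem_formKer, Matrix.dotProduct_mulVec, hlE]
      exact hw.2
    · intro g hg _
      have : g = 1 := by
        ext1
        refine Matrix.ext_of_mulVec_single fun k => ?_
        rw [hg _ trivial, Units.val_one, Matrix.one_mulVec]
      rw [this, map_one, Module.End.one_apply]
  have h1 := h.finrank_le hπ _ hE rfl
  have h2 := finrank_inf_fixedSpace_inf_formKer (W := ⊤) hE hlE (fun _ _ => trivial) hex
  have h3 := inf_formKer_inf_fixedSpace_one_sub (W := ⊤) hlE
  rw [h3] at h1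
  rw [top_inf_eq (fixedSpace (1 - E))] at h1
  rw [top_inf_eq (fixedSpace E)] at h2
  omega

/-- If a cuspidal representation of `GL_n(F)` with `n ≥ 2` has a nonzero vector fixed by the
transvections of both eigenspaces of an idempotent, these eigenspaces have equal dimensions. -/
theorem finrank_fixedSpace_eq [Finite F] (hn : 2 ≤ n) (hπ : IsCuspidal π)
    {E : Matrix (Fin n) (Fin n) F} (hE : E * E = E) {v : V} (hv : v ≠ 0)
    (h₁ : FixedByTransvections π E ⊤ v) (h₂ : FixedByTransvections π (1 - E) ⊤ v) :
    Module.finrank F (fixedSpace E) = Module.finrank F (fixedSpace (1 - E)) := by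
  have hE' : (1 - E) * (1 - E) = 1 - E := by
    rw [mul_sub, mul_one, sub_mul, one_mul, hE, sub_self, sub_zero]
  have hzero : Module.finrank F (fixedSpace (0 : Matrix (Fin n) (Fin n) F)) = 0 := by
    rw [Submodule.finrank_eq_zero, eq_bot_iff]
    intro x hx
    rw [mem_fixedSpace, Matrix.zero_mulVec] at hx
    exact hx.symm
  have hone : Module.finrank F (fixedSpace (1 : Matrix (Fin n) (Fin n) F)) = n := by
    have : fixedSpace (1 : Matrix (Fin n) (Fin n) F) = ⊤ :=
      eq_top_iff.2 fun x _ => Matrix.one_mulVec x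
    rw [this, finrank_top, Module.finrank_fin_fun]
  by_cases h0 : E = 0
  · subst h0
    have := finrank_fixedSpace_bounds hπ hE' (by
      rw [sub_zero]
      intro h
      have := congrFun (congrFun h ⟨0, by omega⟩) ⟨0, by omega⟩
      simp at this) hv h₂ (by rwa [sub_sub_cancel])
    rw [sub_sub_cancel, hzero, sub_zero, hone] at this
    omega
  by_cases h0' : 1 - E = 0
  · have hE1 : E = 1 := (sub_eq_zero.1 h0').symm
    have := finrank_fixedSpace_bounds hπ hE h0 hv h₁ h₂
    rw [h0', hzero, hE1, hone] at this
    omega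
  have ha := finrank_fixedSpace_bounds hπ hE h0 hv h₁ h₂
  have hb := finrank_fixedSpace_bounds hπ hE' h0' hv h₂ (by rwa [sub_sub_cancel])
  rw [sub_sub_cancel] at hb
  omega

end CuspidalPeriods

section Mackey

variable {G P H A : Type*} [Group G] [Group P] [Group H] [AddCommGroup A] [Module ℂ A]
  (φ : P →* G) (σ : Representation ℂ P A) (j : H →* G) (χ : H →* ℂˣ)

/-- The contribution of the double coset `P s H` to the `χ`-eigenvectors of `H` in the
representation coinduced from `σ`. -/
def mackeySpace (s : G) : Submodule ℂ A where
  carrier := {v | ∀ p h, φ p * s = s * j h → σ p v = (χ h : ℂ) • v}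
  add_mem' {v w} hv hw p h e := by rw [map_add, hv p h e, hw p h e, smul_add]
  zero_mem' p h _ := by simp
  smul_mem' c v hv p h e := by rw [map_smul, hv p h e, smul_comm]

/-- The `χ`-eigenvectors of `H` in the representation coinduced from `σ`. -/
noncomputable abbrev coindEigenvectors : Submodule ℂ (Representation.coindV φ σ) :=
  eigenvectors ((Representation.coind φ σ).comp j) χ

variable {φ σ j χ}

theorem coindEigenvectors_apply_mul (f : coindEigenvectors φ σ j χ) (x : G) (h : H) :
    f.1.1 (x * j h) = (χ h : ℂ) • f.1.1 x :=
  congrFun (congrArg Subtype.val (f.2 h)) x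

theorem coindEigenvectors_mul_apply (f : coindEigenvectors φ σ j χ) (p : P) (x : G) :
    f.1.1 (φ p * x) = σ p (f.1.1 x) :=
  f.1.2 p x

theorem coindEigenvectors_apply_mem (f : coindEigenvectors φ σ j χ) (s : G) :
    f.1.1 s ∈ mackeySpace φ σ j χ s := by
  intro p h e
  rw [← coindEigenvectors_mul_apply, e, coindEigenvectors_apply_mul]

variable (φ σ j χ) in
/-- Evaluation of eigenvectors at representatives of double cosets. -/
noncomputable def mackeyEval {I : Type*} (s : I → G) :
    coindEigenvectors φ σ j χ →ₗ[ℂ] (i : I) → mackeySpace φ σ j χ (s i) where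
  toFun f i := ⟨f.1.1 (s i), coindEigenvectors_apply_mem f (s i)⟩
  map_add' _ _ := rfl
  map_smul' _ _ := rfl

theorem mackeyEval_injective {I : Type*} {s : I → G}
    (hs : ∀ (f : coindEigenvectors φ σ j χ) (x : G), f.1.1 x ≠ 0 →
      ∃ i p h, x = φ p * s i * j h) : Function.Injective (mackeyEval φ σ j χ s) := by
  rw [injective_iff_map_eq_zero]
  intro f hf
  refine Subtype.ext (Subtype.ext (funext fun x => ?_))
  by_contra hx
  obtain ⟨i, p, h, rfl⟩ := hs f x hx
  have h0 : f.1.1 (s i) = 0 := congrArg Subtype.val (congrFun hf i)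
  refine hx ?_
  rw [coindEigenvectors_apply_mul, coindEigenvectors_mul_apply, h0, map_zero, smul_zero]
  rfl

theorem mackey_apply_eq {s : G} {v : A} (hv : v ∈ mackeySpace φ σ j χ s) {p p' : P} {h h' : H}
    (e : φ p * s * j h = φ p' * s * j h') :
    (χ h : ℂ) • σ p v = (χ h' : ℂ) • σ p' v := by
  have e' : φ (p'⁻¹ * p) * s = s * j (h' * h⁻¹) := by
    rw [map_mul, map_inv, map_mul, map_inv, mul_assoc, inv_mul_eq_iff_eq_mul, ← mul_assoc,
      ← mul_assoc, eq_mul_inv_iff_mul_eq, e]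
  have h1 := congrArg (fun z => (χ h : ℂ) • σ p' z) (hv _ _ e')
  simp only [map_smul] at h1
  rw [← Module.End.mul_apply, ← map_mul, mul_inv_cancel_left, smul_smul, map_mul, Units.val_mul,
    mul_left_comm, ← Units.val_mul (χ h), ← map_mul, mul_inv_cancel, map_one, Units.val_one,
    mul_one] at h1
  exact h1

open Classical in
variable (φ σ j χ) in
/-- The function supported on the double coset `P s H` with value `v` at `s`. -/
noncomputable def mackeyFun (s : G) (v : A) (x : G) : A :=
  if hx : ∃ ph : P × H, x = φ ph.1 * s * j ph.2 then
    (χ hx.choose.2 : ℂ) • σ hx.choose.1 v else 0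

theorem mackeyFun_apply {s : G} {v : A} (hv : v ∈ mackeySpace φ σ j χ s) (p : P) (h : H) :
    mackeyFun φ σ j χ s v (φ p * s * j h) = (χ h : ℂ) • σ p v := by
  have hx : ∃ ph : P × H, φ p * s * j h = φ ph.1 * s * j ph.2 := ⟨(p, h), rfl⟩
  rw [mackeyFun, dif_pos hx]
  exact (mackey_apply_eq hv hx.choose_spec).symm

theorem mackeyFun_apply_self {s : G} {v : A} (hv : v ∈ mackeySpace φ σ j χ s) :
    mackeyFun φ σ j χ s v s = v := by
  have := mackeyFun_apply hv 1 1
  rwa [map_one, map_one, one_mul, mul_one, map_one, map_one, Units.val_one, one_smul,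
    Module.End.one_apply] at this

theorem mackeyFun_mul {s : G} {v : A} (hv : v ∈ mackeySpace φ σ j χ s) (q : P) (k : H) (x : G) :
    mackeyFun φ σ j χ s v (φ q * x * j k) = (χ k : ℂ) • σ q (mackeyFun φ σ j χ s v x) := by
  by_cases hx : ∃ ph : P × H, x = φ ph.1 * s * j ph.2
  · obtain ⟨⟨p, h⟩, rfl⟩ := hx
    have e : φ q * (φ p * s * j h) * j k = φ (q * p) * s * j (h * k) := by
      simp only [map_mul, mul_assoc]
    rw [e, mackeyFun_apply hv, mackeyFun_apply hv, map_mul, map_mul, map_smul, smul_smul,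
      Units.val_mul, mul_comm, Module.End.mul_apply]
  · have hx' : ¬ ∃ ph : P × H, φ q * x * j k = φ ph.1 * s * j ph.2 := by
      rintro ⟨⟨p, h⟩, e⟩
      refine hx ⟨(q⁻¹ * p, h * k⁻¹), ?_⟩
      simp only [map_mul, map_inv]
      rw [← mul_assoc, eq_mul_inv_iff_mul_eq, mul_assoc, mul_assoc, eq_inv_mul_iff_mul_eq,
        ← mul_assoc, e, mul_assoc]
    rw [mackeyFun, mackeyFun, dif_neg hx, dif_neg hx', map_zero, smul_zero]

variable (φ σ j χ) in
/-- The eigenvector supported on the double coset `P s H` with value `v` at `s`. -/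
noncomputable def mackeyVector (s : G) (v : mackeySpace φ σ j χ s) :
    coindEigenvectors φ σ j χ :=
  ⟨⟨mackeyFun φ σ j χ s v.1, fun p x => by
    have := mackeyFun_mul v.2 p 1 x
    rwa [map_one, mul_one, map_one, Units.val_one, one_smul] at this⟩, fun h => by
    refine Subtype.ext (funext fun x => ?_)
    have := mackeyFun_mul v.2 1 h x
    rw [map_one, one_mul, map_one, Module.End.one_apply] at this
    exact this⟩

theorem mackeyEval_surjective {I : Type*} [Fintype I] {s : I → G}
    (hs : ∀ i i' p h, φ p * s i = s i' * j h → i = i') :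
    Function.Surjective (mackeyEval φ σ j χ s) := by
  intro v
  refine ⟨∑ i, mackeyVector φ σ j χ (s i) (v i), ?_⟩
  rw [map_sum]
  funext k
  rw [Finset.sum_apply, Finset.sum_eq_single k]
  · exact Subtype.ext (mackeyFun_apply_self (v k).2)
  · intro i _ hik
    refine Subtype.ext ?_
    change mackeyFun φ σ j χ (s i) (v i).1 (s k) = 0
    rw [mackeyFun, dif_neg]
    rintro ⟨⟨p, h⟩, e⟩
    refine hik (hs i k p h⁻¹ ?_)
    rw [map_inv, eq_mul_inv_iff_mul_eq, e]
  · intro h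
    exact absurd (Finset.mem_univ k) h

end Mackey

section Contraction

variable {V₁ V₂ : Type*} [AddCommGroup V₁] [Module ℂ V₁] [AddCommGroup V₂] [Module ℂ V₂]

/-- Contraction of the first factor of a tensor with a linear form. -/
noncomputable def contract (φ : Module.Dual ℂ V₁) : TensorProduct ℂ V₁ V₂ →ₗ[ℂ] V₂ :=
  (TensorProduct.lid ℂ V₂).toLinearMap ∘ₗ φ.rTensor V₂

@[simp]
theorem contract_tmul (φ : Module.Dual ℂ V₁) (v : V₁) (w : V₂) :
    contract φ (v ⊗ₜ[ℂ] w) = φ v • w := by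
  simp [contract]

theorem contract_map (φ : Module.Dual ℂ V₁) (a : V₁ →ₗ[ℂ] V₁) (b : V₂ →ₗ[ℂ] V₂)
    (z : TensorProduct ℂ V₁ V₂) :
    contract φ (TensorProduct.map a b z) = b (contract (φ ∘ₗ a) z) := by
  induction z with
  | zero => simp
  | tmul v w => simp
  | add x y hx hy => simp only [map_add, hx, hy]

theorem eq_zero_of_contract_eq_zero {z : TensorProduct ℂ V₁ V₂}
    (h : ∀ φ : Module.Dual ℂ V₁, contract φ z = 0) : z = 0 := by
  classical
  let b := Module.Basis.ofVectorSpace ℂ V₁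
  have key : ∀ (z : TensorProduct ℂ V₁ V₂) i,
      TensorProduct.equivFinsuppOfBasisLeft b z i = contract (b.coord i) z := by
    intro z i
    induction z with
    | zero => simp
    | tmul v w => simp
    | add x y hx hy => simp only [map_add, Finsupp.add_apply, hx, hy]
  rw [← (TensorProduct.equivFinsuppOfBasisLeft b).map_eq_zero_iff]
  ext i
  rw [key, h]
  rfl

variable (V₁ V₂) in
/-- The map `V₁ ⊗ V₂ → Hom(V₁^*, V₂)`. -/
noncomputable def contractHom : TensorProduct ℂ V₁ V₂ →ₗ[ℂ] Module.Dual ℂ V₁ →ₗ[ℂ] V₂ where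
  toFun z :=
    { toFun := fun φ => contract φ z
      map_add' := fun φ ψ => by simp [contract, LinearMap.rTensor_add]
      map_smul' := fun c φ => by simp [contract, LinearMap.rTensor_smul] }
  map_add' x y := by ext φ; exact map_add (contract φ) x y
  map_smul' c x := by ext φ; exact map_smul (contract φ) c x

theorem contractHom_apply (z : TensorProduct ℂ V₁ V₂) (φ : Module.Dual ℂ V₁) :
    contractHom V₁ V₂ z φ = contract φ z := rfl

theorem contractHom_injective : Function.Injective (contractHom V₁ V₂) := by
  rw [injective_iff_map_eq_zero]
  exact fun z hz => eq_zero_of_contract_eq_zero fun φ => LinearMap.congr_fun hz φ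

variable (V₁ V₂) in
/-- The isomorphism `V₁ ⊗ V₂ ≃ Hom(V₁^*, V₂)`. -/
noncomputable def contractEquiv [FiniteDimensional ℂ V₁] [FiniteDimensional ℂ V₂] :
    TensorProduct ℂ V₁ V₂ ≃ₗ[ℂ] (Module.Dual ℂ V₁ →ₗ[ℂ] V₂) :=
  (contractHom V₁ V₂).linearEquivOfInjective contractHom_injective (by
    rw [Module.finrank_tensorProduct, Module.finrank_linearMap, Subspace.dual_finrank_eq])

end Contraction

section Multiplicity

variable {K V : Type*} [Group K] [AddCommGroup V] [Module ℂ V]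

/-- The projection onto the `θ`-eigenvectors of a finite group. -/
noncomputable def eigenProj [Fintype K] (ρ : Representation ℂ K V) (θ : K →* ℂˣ) : V →ₗ[ℂ] V :=
  (Fintype.card K : ℂ)⁻¹ • ∑ k, ((θ k)⁻¹ : ℂˣ).1 • ρ k

variable [Fintype K] {ρ : Representation ℂ K V} {θ : K →* ℂˣ}

theorem eigenProj_apply (v : V) :
    eigenProj ρ θ v = (Fintype.card K : ℂ)⁻¹ • ∑ k, ((θ k)⁻¹ : ℂˣ).1 • ρ k v := by
  simp [eigenProj]

theorem eigenProj_mem (v : V) : eigenProj ρ θ v ∈ eigenvectors ρ θ := by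
  intro g
  rw [eigenProj_apply, map_smul, smul_comm (θ g : ℂ), map_sum, Finset.smul_sum (r := (θ g : ℂ))]
  congr 1
  rw [← Equiv.sum_comp (Equiv.mulLeft g) (fun k => (θ g : ℂ) • ((θ k)⁻¹ : ℂˣ).1 • ρ k v)]
  refine Finset.sum_congr rfl fun k _ => ?_
  rw [map_smul, smul_smul, Equiv.coe_mulLeft, map_mul, map_mul, mul_inv, Units.val_mul, ← mul_assoc,
    ← Units.val_mul, mul_inv_cancel, Units.val_one, one_mul, Module.End.mul_apply]

theorem average_const {A : Type*} [AddCommGroup A] [Module ℂ A] (a : A) :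
    (Fintype.card K : ℂ)⁻¹ • ∑ _k : K, a = a := by
  rw [Finset.sum_const, Finset.card_univ, ← Nat.cast_smul_eq_nsmul ℂ, smul_smul,
    inv_mul_cancel₀ (Nat.cast_ne_zero.2 Fintype.card_ne_zero), one_smul]

theorem eigenProj_of_mem {v : V} (hv : v ∈ eigenvectors ρ θ) : eigenProj ρ θ v = v := by
  rw [eigenProj_apply]
  have : ∀ k, ((θ k)⁻¹ : ℂˣ).1 • ρ k v = v := fun k => by
    rw [hv k, smul_smul, ← Units.val_mul, inv_mul_cancel, Units.val_one, one_smul]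
  simp only [this]
  exact average_const v

theorem intertwiningMap_eigenProj (f : Representation.IntertwiningMap ρ (charRep θ)) (v : V) :
    f (eigenProj ρ θ v) = f v := by
  rw [eigenProj_apply, map_smul, map_sum]
  have : ∀ k, f (((θ k)⁻¹ : ℂˣ).1 • ρ k v) = f v := fun k => by
    rw [map_smul, f.isIntertwining]
    change ((θ k)⁻¹ : ℂˣ).1 • ((θ k : ℂ) • f v) = f v
    rw [smul_smul, ← Units.val_mul, inv_mul_cancel, Units.val_one, one_smul]
  simp only [this]
  exact average_const (f v)

variable (ρ θ) in
/-- A homomorphism to the character `θ` is a linear form on the `θ`-eigenvectors. -/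
noncomputable def intertwiningMapEquivDual :
    Representation.IntertwiningMap ρ (charRep θ) ≃ₗ[ℂ] Module.Dual ℂ (eigenvectors ρ θ) where
  toFun f := f.toLinearMap ∘ₗ (eigenvectors ρ θ).subtype
  map_add' _ _ := rfl
  map_smul' _ _ := rfl
  invFun φ :=
    { toLinearMap := φ ∘ₗ (eigenProj ρ θ).codRestrict _ eigenProj_mem
      isIntertwining' := fun g => by
        ext v
        change φ _ = (θ g : ℂ) • φ _
        rw [← map_smul]
        congr 1
        refine Subtype.ext ?_
        change eigenProj ρ θ (ρ g v) = (θ g : ℂ) • eigenProj ρ θ v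
        rw [eigenProj_apply, eigenProj_apply, smul_comm]
        congr 1
        rw [Finset.smul_sum, ← Equiv.sum_comp (Equiv.mulRight g)
          (fun k => (θ g : ℂ) • ((θ k)⁻¹ : ℂˣ).1 • ρ k v)]
        refine Finset.sum_congr rfl fun k _ => ?_
        rw [smul_smul, Equiv.coe_mulRight, map_mul, map_mul, mul_inv, mul_comm, ← Units.val_mul,
          inv_mul_cancel_right, Module.End.mul_apply] }
  left_inv f := by
    ext v
    exact intertwiningMap_eigenProj f v
  right_inv φ := by
    ext v
    exact congrArg φ (Subtype.ext (eigenProj_of_mem v.2))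

theorem mult_eq_finrank_eigenvectors : mult ρ θ = Module.finrank ℂ (eigenvectors ρ θ) := by
  rw [mult, (intertwiningMapEquivDual ρ θ).finrank_eq, Subspace.dual_finrank_eq]

variable {K' V' : Type*} [Group K'] [AddCommGroup V'] [Module ℂ V'] [Fintype K']
  {ρ' : Representation ℂ K' V'} {θ' : K' →* ℂˣ}

variable (ρ θ ρ' θ') in
/-- The eigenvectors of a product of groups in an external tensor product. -/
noncomputable def tensorEigenvectors : Submodule ℂ (TensorProduct ℂ V V') where
  carrier := {z | ∀ k k', TensorProduct.map (ρ k) (ρ' k') z = ((θ k : ℂ) * θ' k') • z}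
  add_mem' {v w} hv hw k k' := by rw [map_add, hv, hw, smul_add]
  zero_mem' k k' := by simp
  smul_mem' c v hv k k' := by rw [map_smul, hv, smul_comm]

theorem range_map_subtype_eigenvectors :
    LinearMap.range (TensorProduct.map (eigenvectors ρ θ).subtype (eigenvectors ρ' θ').subtype) =
      tensorEigenvectors ρ θ ρ' θ' := by
  refine le_antisymm ?_ ?_
  · rintro _ ⟨z, rfl⟩
    induction z with
    | zero => rw [map_zero]; exact Submodule.zero_mem _
    | tmul v w =>
      intro k k'
      rw [TensorProduct.map_tmul, TensorProduct.map_tmul, Submodule.subtype_apply,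
        Submodule.subtype_apply, v.2 k, w.2 k', TensorProduct.smul_tmul_smul]
    | add x y hx hy => rw [map_add]; exact Submodule.add_mem _ hx hy
  · intro z hz
    have h1 : TensorProduct.map (eigenProj ρ θ) LinearMap.id z = z := by
      have : TensorProduct.map (eigenProj ρ θ) LinearMap.id z =
          (Fintype.card K : ℂ)⁻¹ •
            ∑ k, ((θ k)⁻¹ : ℂˣ).1 • TensorProduct.map (ρ k) (LinearMap.id : V' →ₗ[ℂ] V') z := by
        clear hz
        induction z with
        | zero => simp
        | tmul v w =>
          simp only [TensorProduct.map_tmul, eigenProj_apply, ← TensorProduct.smul_tmul',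
            TensorProduct.sum_tmul, LinearMap.id_apply]
        | add x y hx hy => simp only [map_add, hx, hy, smul_add, Finset.sum_add_distrib]
      rw [this]
      refine (congrArg _ (Finset.sum_congr rfl fun k _ => ?_)).trans (average_const (K := K) z)
      have := hz k 1
      rw [map_one, map_one, Units.val_one, mul_one] at this
      rw [← Module.End.one_eq_id, this, smul_smul, ← Units.val_mul, inv_mul_cancel, Units.val_one,
        one_smul]
    have h2 : TensorProduct.map LinearMap.id (eigenProj ρ' θ') z = z := by
      have : TensorProduct.map LinearMap.id (eigenProj ρ' θ') z =
          (Fintype.card K' : ℂ)⁻¹ •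
            ∑ k, ((θ' k)⁻¹ : ℂˣ).1 • TensorProduct.map (LinearMap.id : V →ₗ[ℂ] V) (ρ' k) z := by
        clear hz h1
        induction z with
        | zero => simp
        | tmul v w => simp [eigenProj_apply, TensorProduct.tmul_sum, TensorProduct.tmul_smul]
        | add x y hx hy => simp only [map_add, hx, hy, smul_add, Finset.sum_add_distrib]
      rw [this]
      refine (congrArg _ (Finset.sum_congr rfl fun k _ => ?_)).trans (average_const (K := K') z)
      have := hz 1 k
      rw [map_one, map_one, Units.val_one, one_mul] at this
      rw [← Module.End.one_eq_id, this, smul_smul, ← Units.val_mul, inv_mul_cancel, Units.val_one,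
        one_smul]
    refine ⟨TensorProduct.map ((eigenProj ρ θ).codRestrict _ eigenProj_mem)
      ((eigenProj ρ' θ').codRestrict _ eigenProj_mem) z, ?_⟩
    rw [← LinearMap.comp_apply, ← TensorProduct.map_comp, LinearMap.subtype_comp_codRestrict,
      LinearMap.subtype_comp_codRestrict]
    rw [← LinearMap.comp_id (eigenProj ρ θ), ← LinearMap.id_comp (eigenProj ρ' θ'),
      TensorProduct.map_comp, LinearMap.comp_apply, h2, h1]

theorem finrank_tensorEigenvectors :
    Module.finrank ℂ (tensorEigenvectors ρ θ ρ' θ') =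
      Module.finrank ℂ (eigenvectors ρ θ) * Module.finrank ℂ (eigenvectors ρ' θ') := by
  rw [← range_map_subtype_eigenvectors, LinearMap.finrank_range_of_inj,
    Module.finrank_tensorProduct]
  exact TensorProduct.map_injective_of_flat_flat _ _ (Submodule.subtype_injective _)
    (Submodule.subtype_injective _)

end Multiplicity

section Schur

variable {G : Type*} [Group G] {V₁ V₂ : Type*} [AddCommGroup V₁] [Module ℂ V₁]
  [AddCommGroup V₂] [Module ℂ V₂]

theorem twist_apply (ρ : Representation ℂ G V₁) (χ : G →* ℂˣ) (g : G) (v : V₁) :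
    twist ρ χ g v = (χ g : ℂ) • ρ g v := rfl

theorem isIrreducible_of_forall [Nontrivial V₁] {ρ : Representation ℂ G V₁}
    (h : ∀ W : Submodule ℂ V₁, (∀ g, ∀ v ∈ W, ρ g v ∈ W) → W = ⊥ ∨ W = ⊤) :
    ρ.IsIrreducible := by
  have hnt : Nontrivial (Subrepresentation ρ) := by
    refine ⟨⊥, ⊤, fun h => ?_⟩
    obtain ⟨v, hv⟩ := exists_ne (0 : V₁)
    have : v ∈ (⊥ : Subrepresentation ρ) := h ▸ (trivial : v ∈ (⊤ : Subrepresentation ρ))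
    exact hv this
  refine { eq_bot_or_eq_top := fun W => ?_ }
  rcases h W.toSubmodule (fun g v hv => W.apply_mem_toSubmodule g hv) with h | h
  · exact Or.inl (Subrepresentation.toSubmodule_injective h)
  · exact Or.inr (Subrepresentation.toSubmodule_injective h)

theorem eq_bot_or_eq_top_of_isIrreducible {ρ : Representation ℂ G V₁} (hρ : ρ.IsIrreducible)
    (W : Submodule ℂ V₁) (h : ∀ g, ∀ v ∈ W, ρ g v ∈ W) : W = ⊥ ∨ W = ⊤ := by
  rcases hρ.eq_bot_or_eq_top ⟨W, fun g v hv => h g v hv⟩ with h | h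
  · exact Or.inl (congrArg Subrepresentation.toSubmodule h)
  · exact Or.inr (congrArg Subrepresentation.toSubmodule h)

theorem nontrivial_of_isIrreducible {ρ : Representation ℂ G V₁} (hρ : ρ.IsIrreducible) :
    Nontrivial V₁ := by
  by_contra hcon
  rw [not_nontrivial_iff_subsingleton] at hcon
  refine bot_ne_top (α := Subrepresentation ρ) (Subrepresentation.toSubmodule_injective ?_)
  exact Subsingleton.elim _ _

theorem finiteDimensional_of_isIrreducible [Finite G] {ρ : Representation ℂ G V₁}
    (hρ : ρ.IsIrreducible) : FiniteDimensional ℂ V₁ := by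
  have := nontrivial_of_isIrreducible hρ
  obtain ⟨v, hv⟩ := exists_ne (0 : V₁)
  let W : Submodule ℂ V₁ := Submodule.span ℂ (Set.range fun g => ρ g v)
  have hvW : v ∈ W := Submodule.subset_span ⟨1, by simp⟩
  have hW : ∀ g, ∀ w ∈ W, ρ g w ∈ W := by
    intro g w hw
    induction hw using Submodule.span_induction with
    | mem x hx =>
      obtain ⟨k, rfl⟩ := hx
      exact Submodule.subset_span ⟨g * k, by simp⟩
    | zero => rw [map_zero]; exact W.zero_mem
    | add x y _ _ hx hy => rw [map_add]; exact W.add_mem hx hy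
    | smul c x _ hx => rw [map_smul]; exact W.smul_mem c hx
  rcases eq_bot_or_eq_top_of_isIrreducible hρ W hW with h | h
  · rw [h] at hvW
    exact absurd hvW hv
  · have : FiniteDimensional ℂ W := FiniteDimensional.span_of_finite ℂ (Set.finite_range _)
    rw [h] at this
    exact Module.finite_def.2 (Module.Finite.iff_fg.1 this)

theorem isIrreducible_twist {ρ : Representation ℂ G V₁} (hρ : ρ.IsIrreducible) (χ : G →* ℂˣ) :
    (twist ρ χ).IsIrreducible := by
  have := nontrivial_of_isIrreducible hρ
  refine isIrreducible_of_forall fun W hW => eq_bot_or_eq_top_of_isIrreducible hρ W ?_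
  intro g v hv
  have := W.smul_mem (((χ g)⁻¹ : ℂˣ) : ℂ) (hW g v hv)
  rwa [twist_apply, smul_smul, ← Units.val_mul, inv_mul_cancel, Units.val_one, one_smul] at this

theorem isIrreducible_dual [FiniteDimensional ℂ V₁] {ρ : Representation ℂ G V₁}
    (hρ : ρ.IsIrreducible) : ρ.dual.IsIrreducible := by
  have := nontrivial_of_isIrreducible hρ
  refine isIrreducible_of_forall fun W hW => ?_
  have h : ∀ g, ∀ v ∈ W.dualCoannihilator, ρ g v ∈ W.dualCoannihilator := by
    intro g v hv
    rw [Submodule.mem_dualCoannihilator] at hv ⊢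
    intro φ hφ
    have := hv _ (hW g⁻¹ φ hφ)
    rwa [Representation.dual_apply, inv_inv] at this
  have hW' := Subspace.dualCoannihilator_dualAnnihilator_eq (W := W)
  rcases eq_bot_or_eq_top_of_isIrreducible hρ _ h with h | h
  · right
    rw [← hW', h, Submodule.dualAnnihilator_bot]
  · left
    rw [← hW', h, Submodule.dualAnnihilator_top]

theorem finrank_intertwiningMap_eq_iverson [FiniteDimensional ℂ V₂] {ρ₁ : Representation ℂ G V₁}
    {ρ₂ : Representation ℂ G V₂} (h₁ : ρ₁.IsIrreducible) (h₂ : ρ₂.IsIrreducible) :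
    Module.finrank ℂ (Representation.IntertwiningMap ρ₁ ρ₂) =
      iverson (Nonempty (Representation.Equiv ρ₁ ρ₂)) := by
  by_cases h : Nonempty (Representation.Equiv ρ₁ ρ₂)
  · rw [iverson, if_pos h]
    obtain ⟨e⟩ := h
    have e' : Representation.IntertwiningMap ρ₁ ρ₂ ≃ₗ[ℂ] Representation.IntertwiningMap ρ₂ ρ₂ :=
      { toFun := fun f => f.comp e.symm.toIntertwiningMap
        invFun := fun f => f.comp e.toIntertwiningMap
        map_add' := fun _ _ => rfl
        map_smul' := fun _ _ => rfl
        left_inv := fun f => by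
          ext v
          exact congrArg f (e.symm_apply_apply v)
        right_inv := fun f => by
          ext v
          exact congrArg f (e.apply_symm_apply v) }
    rw [e'.finrank_eq, Representation.IsIrreducible.finrank_intertwiningMap_self]
  · rw [iverson, if_neg h]
    have := not_nonempty_iff.1 h
    exact Module.finrank_zero_of_subsingleton

end Schur

section BlockMatrices

variable {F : Type*} [Field F] {n : ℕ}

theorem det_one_add_of_mul_self_eq_zero {A : Matrix (Fin n) (Fin n) F} (h : A * A = 0) :
    (1 + A).det = 1 := by
  obtain ⟨f, hf⟩ : ∃ f : (Fin n → F) →ₗ[F] (Fin n → F),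
      ∀ x, A *ᵥ f (A *ᵥ x) = A *ᵥ x := by
    obtain ⟨g, hg⟩ := A.mulVecLin.rangeRestrict.exists_rightInverse_of_surjective
      (LinearMap.range_rangeRestrict _)
    obtain ⟨f, hf⟩ := LinearMap.exists_extend g
    refine ⟨f, fun x => ?_⟩
    have h1 := LinearMap.congr_fun hf (A.mulVecLin.rangeRestrict x)
    have h2 := congrArg Subtype.val (LinearMap.congr_fun hg (A.mulVecLin.rangeRestrict x))
    change f (A *ᵥ x) = _ at h1
    rw [h1]
    exact h2
  have hB : A * (LinearMap.toMatrix' f * A) = A := by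
    refine Matrix.ext_of_mulVec_single fun i => ?_
    rw [← Matrix.mulVec_mulVec, ← Matrix.mulVec_mulVec, LinearMap.toMatrix'_mulVec, hf]
  rw [← hB, Matrix.det_one_add_mul_comm, Matrix.mul_assoc, h, Matrix.mul_zero, add_zero,
    Matrix.det_one]

theorem toBlocks_mul (X Y : Matrix (Fin n ⊕ Fin n) (Fin n ⊕ Fin n) F) :
    (X * Y).toBlocks₁₁ = X.toBlocks₁₁ * Y.toBlocks₁₁ + X.toBlocks₁₂ * Y.toBlocks₂₁ ∧
    (X * Y).toBlocks₁₂ = X.toBlocks₁₁ * Y.toBlocks₁₂ + X.toBlocks₁₂ * Y.toBlocks₂₂ ∧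
    (X * Y).toBlocks₂₁ = X.toBlocks₂₁ * Y.toBlocks₁₁ + X.toBlocks₂₂ * Y.toBlocks₂₁ ∧
    (X * Y).toBlocks₂₂ = X.toBlocks₂₁ * Y.toBlocks₁₂ + X.toBlocks₂₂ * Y.toBlocks₂₂ := by
  have h := Matrix.fromBlocks_multiply X.toBlocks₁₁ X.toBlocks₁₂ X.toBlocks₂₁ X.toBlocks₂₂
    Y.toBlocks₁₁ Y.toBlocks₁₂ Y.toBlocks₂₁ Y.toBlocks₂₂
  rw [Matrix.fromBlocks_toBlocks, Matrix.fromBlocks_toBlocks] at h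
  rw [h]
  simp

theorem toBlocks_one :
    (1 : Matrix (Fin n ⊕ Fin n) (Fin n ⊕ Fin n) F).toBlocks₁₁ = 1 ∧
    (1 : Matrix (Fin n ⊕ Fin n) (Fin n ⊕ Fin n) F).toBlocks₁₂ = 0 ∧
    (1 : Matrix (Fin n ⊕ Fin n) (Fin n ⊕ Fin n) F).toBlocks₂₁ = 0 ∧
    (1 : Matrix (Fin n ⊕ Fin n) (Fin n ⊕ Fin n) F).toBlocks₂₂ = 1 := by
  have h := (Matrix.fromBlocks_one (l := Fin n) (m := Fin n) (α := F)).symm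
  exact ⟨congrArg Matrix.toBlocks₁₁ h, congrArg Matrix.toBlocks₁₂ h,
    congrArg Matrix.toBlocks₂₁ h, congrArg Matrix.toBlocks₂₂ h⟩

theorem mul_inv_toBlocks (x : GL (Fin n ⊕ Fin n) F) :
    x.1.toBlocks₂₁ * (x⁻¹).1.toBlocks₁₁ + x.1.toBlocks₂₂ * (x⁻¹).1.toBlocks₂₁ = 0 ∧
    x.1.toBlocks₂₁ * (x⁻¹).1.toBlocks₁₂ + x.1.toBlocks₂₂ * (x⁻¹).1.toBlocks₂₂ = 1 := by
  have h : x.1 * (x⁻¹).1 = 1 := by rw [← Units.val_mul, mul_inv_cancel, Units.val_one]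
  have h' := toBlocks_mul x.1 (x⁻¹).1
  rw [h] at h'
  exact ⟨h'.2.2.1.symm.trans toBlocks_one.2.2.1, h'.2.2.2.symm.trans toBlocks_one.2.2.2⟩

theorem inv_mul_toBlocks (x : GL (Fin n ⊕ Fin n) F) :
    (x⁻¹).1.toBlocks₁₁ * x.1.toBlocks₁₁ + (x⁻¹).1.toBlocks₁₂ * x.1.toBlocks₂₁ = 1 ∧
    (x⁻¹).1.toBlocks₁₁ * x.1.toBlocks₁₂ + (x⁻¹).1.toBlocks₁₂ * x.1.toBlocks₂₂ = 0 ∧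
    (x⁻¹).1.toBlocks₂₁ * x.1.toBlocks₁₁ + (x⁻¹).1.toBlocks₂₂ * x.1.toBlocks₂₁ = 0 ∧
    (x⁻¹).1.toBlocks₂₁ * x.1.toBlocks₁₂ + (x⁻¹).1.toBlocks₂₂ * x.1.toBlocks₂₂ = 1 := by
  have h : (x⁻¹).1 * x.1 = 1 := by rw [← Units.val_mul, inv_mul_cancel, Units.val_one]
  have h' := toBlocks_mul (x⁻¹).1 x.1
  rw [h, toBlocks_one.1, toBlocks_one.2.1, toBlocks_one.2.2.1, toBlocks_one.2.2.2] at h'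
  exact ⟨h'.1.symm, h'.2.1.symm, h'.2.2.1.symm, h'.2.2.2.symm⟩

theorem blockDiag_val (h : GL (Fin n) F × GL (Fin n) F) :
    (blockDiag n h).1 = Matrix.fromBlocks h.1.1 0 0 h.2.1 := rfl

theorem pairChar_apply (χ₁ χ₂ : Fˣ →* ℂˣ) (h : GL (Fin n) F × GL (Fin n) F) :
    pairChar n χ₁ χ₂ h = χ₁ (Matrix.GeneralLinearGroup.det h.1) *
      χ₂ (Matrix.GeneralLinearGroup.det h.2) := rfl

/-- The matrix `1 + A` as an element of `GL_n(F)`, if its determinant is `1`. -/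
def oneAddUnit (A : Matrix (Fin n) (Fin n) F) (h : (1 + A).det = 1) : GL (Fin n) F :=
  Matrix.GeneralLinearGroup.mkOfDetNeZero (1 + A) (by rw [h]; exact one_ne_zero)

theorem oneAddUnit_val (A : Matrix (Fin n) (Fin n) F) (h : (1 + A).det = 1) :
    (oneAddUnit A h).1 = 1 + A := rfl

theorem det_oneAddUnit (A : Matrix (Fin n) (Fin n) F) (h : (1 + A).det = 1) :
    Matrix.GeneralLinearGroup.det (oneAddUnit A h) = 1 :=
  Units.ext h

end BlockMatrices

section Induced

variable {F : Type*} [Field F] {n : ℕ} {V₁ V₂ : Type*} [AddCommGroup V₁] [Module ℂ V₁]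
  [AddCommGroup V₂] [Module ℂ V₂] {π₁ : Representation ℂ (GL (Fin n) F) V₁}
  {π₂ : Representation ℂ (GL (Fin n) F) V₂} {χ₁ χ₂ : Fˣ →* ℂˣ}

theorem inflation_apply (p : parabolic F n) (a d : GL (Fin n) F) (ha : p.1.1.toBlocks₁₁ = a.1)
    (hd : p.1.1.toBlocks₂₂ = d.1) :
    inflation π₁ π₂ p = TensorProduct.map (π₁ a) (π₂ d) := by
  have h1 : (leviQuotient F n p).1 = a := Units.ext ha
  have h2 : (leviQuotient F n p).2 = d := Units.ext hd
  rw [← h1, ← h2]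
  rfl

theorem indEigenvectors_parabolic_apply (f : indEigenvectors π₁ π₂ χ₁ χ₂)
    (p x : GL (Fin n ⊕ Fin n) F) (hp : p.1.toBlocks₂₁ = 0) (a d : GL (Fin n) F)
    (ha : p.1.toBlocks₁₁ = a.1) (hd : p.1.toBlocks₂₂ = d.1) :
    f.1.1 (p * x) = TensorProduct.map (π₁ a) (π₂ d) (f.1.1 x) := by
  rw [← inflation_apply ⟨p, hp⟩ a d ha hd]
  exact f.1.2 ⟨p, hp⟩ x

theorem indEigenvectors_blockDiag_apply (f : indEigenvectors π₁ π₂ χ₁ χ₂)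
    (x : GL (Fin n ⊕ Fin n) F) (h : GL (Fin n) F × GL (Fin n) F) :
    f.1.1 (x * blockDiag n h) = (pairChar n χ₁ χ₂ h : ℂ) • f.1.1 x :=
  congrFun (congrArg Subtype.val (f.2 h)) x

/-- The value at `x` of an eigenvector in `π₁ × π₂` is fixed by those elements `1 + N` in the second
factor that come from a conjugate of a pair of matrices of determinant `1`. -/
theorem indEigenvectors_apply_fixed (f : indEigenvectors π₁ π₂ χ₁ χ₂)
    (x : GL (Fin n ⊕ Fin n) F) (q : GL (Fin n) F) (N M₁ M₂ : Matrix (Fin n) (Fin n) F)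
    (hq : q.1 = 1 + N)
    (hM₁ : x.1.toBlocks₂₁ * M₁ * x.1.toBlocks₂₁ = N * x.1.toBlocks₂₁)
    (hM₂ : x.1.toBlocks₂₂ * M₂ * x.1.toBlocks₂₂ = N * x.1.toBlocks₂₂)
    (hM₁' : M₁ * (x.1.toBlocks₂₁ * (x⁻¹).1.toBlocks₁₁) = 0)
    (hM₂' : M₂ * (x.1.toBlocks₂₂ * (x⁻¹).1.toBlocks₂₁) = 0)
    (hd₁ : (1 + x.1.toBlocks₂₁ * M₁).det = 1) (hd₂ : (1 + x.1.toBlocks₂₂ * M₂).det = 1) :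
    TensorProduct.map LinearMap.id (π₂ q) (f.1.1 x) = f.1.1 x := by
  rw [Matrix.det_one_add_mul_comm] at hd₁ hd₂
  set h : GL (Fin n) F × GL (Fin n) F := (oneAddUnit _ hd₁, oneAddUnit _ hd₂) with hh
  set p := x * blockDiag n h * x⁻¹ with hp
  have hpx : p * x = x * blockDiag n h := inv_mul_cancel_right _ _
  have hpv : p.1 = 1 + x.1 * (Matrix.fromBlocks (M₁ * x.1.toBlocks₂₁) 0 0
      (M₂ * x.1.toBlocks₂₂) * (x⁻¹).1) := by
    have h1 : (blockDiag n h).1 = 1 + Matrix.fromBlocks (M₁ * x.1.toBlocks₂₁) 0 0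
        (M₂ * x.1.toBlocks₂₂) := by
      rw [blockDiag_val, ← Matrix.fromBlocks_one, Matrix.fromBlocks_add, hh]
      simp only [oneAddUnit_val, add_zero]
    have h2 : x.1 * (x⁻¹).1 = 1 := by rw [← Units.val_mul, mul_inv_cancel, Units.val_one]
    rw [hp, Units.val_mul, Units.val_mul, h1, mul_add, mul_one, add_mul, h2, mul_assoc]
  have hblk : Matrix.fromBlocks (M₁ * x.1.toBlocks₂₁) 0 0 (M₂ * x.1.toBlocks₂₂) * (x⁻¹).1 =
      Matrix.fromBlocks 0 (M₁ * x.1.toBlocks₂₁ * (x⁻¹).1.toBlocks₁₂)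
        0 (M₂ * x.1.toBlocks₂₂ * (x⁻¹).1.toBlocks₂₂) := by
    conv_lhs => rw [← Matrix.fromBlocks_toBlocks (x⁻¹).1, Matrix.fromBlocks_multiply]
    simp only [Matrix.zero_mul, add_zero, zero_add, Matrix.mul_assoc, hM₁', hM₂']
  have hpb : p.1 = Matrix.fromBlocks 1
      (x.1.toBlocks₁₁ * (M₁ * x.1.toBlocks₂₁ * (x⁻¹).1.toBlocks₁₂) +
        x.1.toBlocks₁₂ * (M₂ * x.1.toBlocks₂₂ * (x⁻¹).1.toBlocks₂₂)) 0 (1 + N) := by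
    rw [hpv, hblk]
    have hmul := Matrix.fromBlocks_multiply (p := Fin n) x.1.toBlocks₁₁ x.1.toBlocks₁₂ x.1.toBlocks₂₁
      x.1.toBlocks₂₂ 0 (M₁ * x.1.toBlocks₂₁ * (x⁻¹).1.toBlocks₁₂)
      0 (M₂ * x.1.toBlocks₂₂ * (x⁻¹).1.toBlocks₂₂)
    rw [Matrix.fromBlocks_toBlocks] at hmul
    rw [hmul, ← Matrix.fromBlocks_one, Matrix.fromBlocks_add]
    congr 1
    · simp
    · simp
    · simp
    · rw [← mul_assoc, ← mul_assoc, hM₁, ← mul_assoc x.1.toBlocks₂₂, ← mul_assoc x.1.toBlocks₂₂,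
        hM₂, mul_assoc, mul_assoc, ← mul_add, (mul_inv_toBlocks x).2, mul_one]
  have h1 := indEigenvectors_parabolic_apply f p x (by rw [hpb, Matrix.toBlocks_fromBlocks₂₁]) 1 q
    (by rw [hpb, Matrix.toBlocks_fromBlocks₁₁, Units.val_one])
    (by rw [hpb, Matrix.toBlocks_fromBlocks₂₂, hq])
  rw [hpx, indEigenvectors_blockDiag_apply, pairChar_apply, hh, det_oneAddUnit, det_oneAddUnit,
    map_one, map_one, mul_one, Units.val_one, one_smul, map_one] at h1
  exact h1.symm

theorem apply_eq_zero_of_range_ne (hπ₂ : IsCuspidal π₂) (f : indEigenvectors π₁ π₂ χ₁ χ₂)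
    (x : GL (Fin n ⊕ Fin n) F)
    (hbot : LinearMap.range (x.1.toBlocks₂₁ * (x⁻¹).1.toBlocks₁₁).mulVecLin ≠ ⊥)
    (htop : LinearMap.range (x.1.toBlocks₂₁ * (x⁻¹).1.toBlocks₁₁).mulVecLin ≠ ⊤) :
    f.1.1 x = 0 := by
  set Z := x.1.toBlocks₂₁ * (x⁻¹).1.toBlocks₁₁ with hZ
  have hZ' : x.1.toBlocks₂₂ * (x⁻¹).1.toBlocks₂₁ = -Z :=
    eq_neg_of_add_eq_zero_right (mul_inv_toBlocks x).1
  clear_value Z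
  obtain ⟨g, hg⟩ := Z.mulVecLin.rangeRestrict.exists_rightInverse_of_surjective
    (LinearMap.range_rangeRestrict _)
  obtain ⟨k, hk⟩ := LinearMap.exists_extend g
  have hkZ : ∀ y ∈ LinearMap.range Z.mulVecLin, Z *ᵥ k y = y := by
    intro y hy
    have h1 := LinearMap.congr_fun hk ⟨y, hy⟩
    have h2 := congrArg Subtype.val (LinearMap.congr_fun hg ⟨y, hy⟩)
    change k y = _ at h1
    rw [h1]
    exact h2
  refine eq_zero_of_contract_eq_zero fun φ => hπ₂.cuspidal _ hbot htop _ fun u hu => ?_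
  have hfix : TensorProduct.map LinearMap.id (π₂ u) (f.1.1 x) = f.1.1 x := by
    set N := u.1 - 1 with hN
    have hNZ : N * Z = 0 := by
      refine Matrix.ext_of_mulVec_single fun i => ?_
      rw [← Matrix.mulVec_mulVec, hN, Matrix.sub_mulVec, Matrix.one_mulVec,
        hu.1 (Z *ᵥ _) ⟨_, rfl⟩, sub_self, Matrix.zero_mulVec]
    have hK : Z * (LinearMap.toMatrix' k * N) = N := by
      refine Matrix.ext_of_mulVec_single fun i => ?_
      rw [← Matrix.mulVec_mulVec, ← Matrix.mulVec_mulVec, LinearMap.toMatrix'_mulVec]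
      refine hkZ _ ?_
      rw [hN, Matrix.sub_mulVec, Matrix.one_mulVec]
      exact hu.2 _
    have hNN : N * N = 0 := by
      rw [← hK, ← mul_assoc, mul_assoc Z, mul_assoc _ N Z, hNZ, mul_zero, mul_zero, zero_mul]
    have hd := det_one_add_of_mul_self_eq_zero hNN
    have e₁ : x.1.toBlocks₂₁ * ((x⁻¹).1.toBlocks₁₁ * (LinearMap.toMatrix' k * N)) = N := by
      rw [← mul_assoc, ← hZ, hK]
    have e₂ : x.1.toBlocks₂₂ * (-((x⁻¹).1.toBlocks₂₁ * (LinearMap.toMatrix' k * N))) = N := by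
      rw [mul_neg, ← mul_assoc, hZ', neg_mul, neg_neg, hK]
    refine indEigenvectors_apply_fixed f x u N
      ((x⁻¹).1.toBlocks₁₁ * (LinearMap.toMatrix' k * N))
      (-((x⁻¹).1.toBlocks₂₁ * (LinearMap.toMatrix' k * N))) ?_ ?_ ?_ ?_ ?_ ?_ ?_
    · rw [hN, add_sub_cancel]
    · rw [e₁]
    · rw [e₂]
    · rw [← hZ, mul_assoc, mul_assoc, hNZ, mul_zero, mul_zero]
    · rw [hZ', neg_mul_neg, mul_assoc, mul_assoc, hNZ, mul_zero, mul_zero]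
    · rw [e₁, hd]
    · rw [e₂, hd]
  conv_rhs => rw [← hfix, contract_map]
  rfl

theorem vecMulVec_mul_self_eq_zero {w μ : Fin n → F} (h : μ ⬝ᵥ w = 0) :
    Matrix.vecMulVec w μ * Matrix.vecMulVec w μ = 0 := by
  rw [Matrix.vecMulVec_mul_vecMulVec, h, zero_smul, Matrix.vecMulVec_zero]

theorem blocks_idempotent (x : GL (Fin n ⊕ Fin n) F)
    (hx : x.1.toBlocks₂₁ * (x⁻¹).1.toBlocks₁₁ = 0) :
    x.1.toBlocks₂₁ * (x⁻¹).1.toBlocks₁₂ * x.1.toBlocks₂₁ = x.1.toBlocks₂₁ ∧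
    x.1.toBlocks₂₁ * (x⁻¹).1.toBlocks₁₂ * x.1.toBlocks₂₂ = 0 ∧
    x.1.toBlocks₂₂ * (x⁻¹).1.toBlocks₂₂ * x.1.toBlocks₂₁ = 0 ∧
    x.1.toBlocks₂₂ * (x⁻¹).1.toBlocks₂₂ * x.1.toBlocks₂₂ = x.1.toBlocks₂₂ := by
  have hx' : x.1.toBlocks₂₂ * (x⁻¹).1.toBlocks₂₁ = 0 := by
    have := (mul_inv_toBlocks x).1
    rwa [hx, zero_add] at this
  obtain ⟨h1, h2, h3, h4⟩ := inv_mul_toBlocks x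
  refine ⟨?_, ?_, ?_, ?_⟩
  · rw [mul_assoc, eq_sub_of_add_eq' h1, mul_sub, mul_one, ← mul_assoc, hx, zero_mul, sub_zero]
  · rw [mul_assoc, eq_neg_of_add_eq_zero_right h2, mul_neg, ← mul_assoc, hx, zero_mul, neg_zero]
  · rw [mul_assoc, eq_neg_of_add_eq_zero_right h3, mul_neg, ← mul_assoc, hx', zero_mul, neg_zero]
  · rw [mul_assoc, eq_sub_of_add_eq' h4, mul_sub, mul_one, ← mul_assoc, hx', zero_mul, sub_zero]

/-- If the ranges of the lower blocks of `x` are complementary and an eigenvector in `π₁ × π₂`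
does not vanish at `x`, these ranges have the same dimension. -/
theorem finrank_fixedSpace_blocks_eq [Finite F] (hn : 2 ≤ n) (hπ₂ : IsCuspidal π₂)
    (f : indEigenvectors π₁ π₂ χ₁ χ₂) (x : GL (Fin n ⊕ Fin n) F)
    (hx : x.1.toBlocks₂₁ * (x⁻¹).1.toBlocks₁₁ = 0) (hf : f.1.1 x ≠ 0) :
    Module.finrank F (fixedSpace (x.1.toBlocks₂₁ * (x⁻¹).1.toBlocks₁₂)) =
      Module.finrank F (fixedSpace (x.1.toBlocks₂₂ * (x⁻¹).1.toBlocks₂₂)) := by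
  obtain ⟨h1, h2, h3, h4⟩ := blocks_idempotent x hx
  have hx' : x.1.toBlocks₂₂ * (x⁻¹).1.toBlocks₂₁ = 0 := by
    have := (mul_inv_toBlocks x).1
    rwa [hx, zero_add] at this
  have hsum := (mul_inv_toBlocks x).2
  set E := x.1.toBlocks₂₁ * (x⁻¹).1.toBlocks₁₂ with hE
  have hE1 : x.1.toBlocks₂₂ * (x⁻¹).1.toBlocks₂₂ = 1 - E := eq_sub_of_add_eq' hsum
  rw [hE1] at h3 h4 ⊢
  have hEE : E * E = E := by
    conv_lhs => rw [hE, ← mul_assoc, ← hE, h1]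
  clear_value E
  obtain ⟨φ, hφ⟩ : ∃ φ : Module.Dual ℂ V₁, contract φ (f.1.1 x) ≠ 0 := by
    by_contra! hcon
    exact hf (eq_zero_of_contract_eq_zero hcon)
  have key : ∀ (w μ : Fin n → F) (h : μ ⬝ᵥ w = 0),
      (E * Matrix.vecMulVec w μ * E = Matrix.vecMulVec w μ ∨
        (1 - E) * Matrix.vecMulVec w μ * (1 - E) = Matrix.vecMulVec w μ) →
      π₂ (transvec w μ h) (contract φ (f.1.1 x)) = contract φ (f.1.1 x) := by
    intro w μ h hor
    have hNN := vecMulVec_mul_self_eq_zero h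
    set N := Matrix.vecMulVec w μ with hN
    have hfix : TensorProduct.map LinearMap.id (π₂ (transvec w μ h)) (f.1.1 x) = f.1.1 x := by
      have e₁ : x.1.toBlocks₂₁ * ((x⁻¹).1.toBlocks₁₂ * N) = E * N := by rw [hE, mul_assoc]
      have e₂ : x.1.toBlocks₂₂ * ((x⁻¹).1.toBlocks₂₂ * N) = (1 - E) * N := by
        rw [← hE1, mul_assoc]
      have hcases : (E * N = N ∧ (1 - E) * N = 0 ∧ N * x.1.toBlocks₂₂ = 0) ∨
          (E * N = 0 ∧ (1 - E) * N = N ∧ N * x.1.toBlocks₂₁ = 0) := by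
        have hz : (1 - E) * E = 0 := by rw [sub_mul, one_mul, hEE, sub_self]
        have hz' : E * (1 - E) = 0 := by rw [mul_sub, mul_one, hEE, sub_self]
        have hEE' : (1 - E) * (1 - E) = 1 - E := by rw [mul_sub, hz, mul_one, sub_zero]
        rcases hor with hor | hor
        · left
          refine ⟨?_, ?_, ?_⟩
          · rw [← hor, ← mul_assoc, ← mul_assoc, hEE]
          · rw [← hor, ← mul_assoc, ← mul_assoc, hz, zero_mul, zero_mul]
          · rw [← hor, mul_assoc, h2, mul_zero]
        · right
          refine ⟨?_, ?_, ?_⟩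
          · rw [← hor, ← mul_assoc, ← mul_assoc, hz', zero_mul, zero_mul]
          · rw [← hor, ← mul_assoc, ← mul_assoc, hEE']
          · rw [← hor, mul_assoc, h3, mul_zero]
      refine indEigenvectors_apply_fixed f x _ N ((x⁻¹).1.toBlocks₁₂ * N)
        ((x⁻¹).1.toBlocks₂₂ * N) rfl ?_ ?_ (by rw [hx, mul_zero]) (by rw [hx', mul_zero]) ?_ ?_
      · rw [e₁]
        rcases hcases with ⟨c1, -, -⟩ | ⟨c1, -, c3⟩
        · rw [c1]
        · rw [c1, c3, zero_mul]
      · rw [e₂]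
        rcases hcases with ⟨-, c2, c3⟩ | ⟨-, c2, -⟩
        · rw [c2, c3, zero_mul]
        · rw [c2]
      · rw [e₁]
        rcases hcases with ⟨c1, -, -⟩ | ⟨c1, -, -⟩
        · rw [c1, det_one_add_of_mul_self_eq_zero hNN]
        · rw [c1, add_zero, Matrix.det_one]
      · rw [e₂]
        rcases hcases with ⟨-, c2, -⟩ | ⟨-, c2, -⟩
        · rw [c2, add_zero, Matrix.det_one]
        · rw [c2, det_one_add_of_mul_self_eq_zero hNN]
    conv_rhs => rw [← hfix, contract_map]
    rfl
  refine finrank_fixedSpace_eq hn hπ₂ hEE hφ ?_ ?_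
  · intro w _ μ h hw hμ
    exact key w μ h (Or.inl (by rw [Matrix.mul_vecMulVec, Matrix.vecMulVec_mul, hw, hμ]))
  · intro w _ μ h hw hμ
    exact key w μ h (Or.inr (by rw [Matrix.mul_vecMulVec, Matrix.vecMulVec_mul, hw, hμ]))

end Induced

section Representatives

variable {F : Type*} [Field F] {n : ℕ}

/-- A representative of the open double coset. -/
def openRep (F : Type*) [Field F] (n : ℕ) : GL (Fin n ⊕ Fin n) F where
  val := Matrix.fromBlocks 1 0 1 1
  inv := Matrix.fromBlocks 1 0 (-1) 1
  val_inv := by simp [Matrix.fromBlocks_multiply]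
  inv_val := by simp [Matrix.fromBlocks_multiply]

theorem exists_eq_mul_openRep (x : GL (Fin n ⊕ Fin n) F) (h₁ : x.1.toBlocks₂₁.det ≠ 0)
    (h₂ : x.1.toBlocks₂₂.det ≠ 0) :
    ∃ (p : parabolic F n) (h : GL (Fin n) F × GL (Fin n) F),
      x = p.1 * openRep F n * blockDiag n h := by
  set h : GL (Fin n) F × GL (Fin n) F := (Matrix.GeneralLinearGroup.mkOfDetNeZero _ h₁,
    Matrix.GeneralLinearGroup.mkOfDetNeZero _ h₂) with hh
  set y := x * blockDiag n h⁻¹ with hy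
  have e₁ : x.1.toBlocks₂₁ * (h.1⁻¹).1 = 1 := by
    change h.1.1 * (h.1⁻¹).1 = 1
    rw [← Units.val_mul, mul_inv_cancel, Units.val_one]
  have e₂ : x.1.toBlocks₂₂ * (h.2⁻¹).1 = 1 := by
    change h.2.1 * (h.2⁻¹).1 = 1
    rw [← Units.val_mul, mul_inv_cancel, Units.val_one]
  have hy' : y.1.toBlocks₂₁ = 1 ∧ y.1.toBlocks₂₂ = 1 := by
    have := toBlocks_mul x.1 (blockDiag n h⁻¹).1
    rw [blockDiag_val] at this
    simp only [Matrix.toBlocks_fromBlocks₁₁, Matrix.toBlocks_fromBlocks₁₂,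
      Matrix.toBlocks_fromBlocks₂₁, Matrix.toBlocks_fromBlocks₂₂, mul_zero, add_zero,
      zero_add, Prod.fst_inv, Prod.snd_inv, e₁, e₂] at this
    exact ⟨this.2.2.1, this.2.2.2⟩
  refine ⟨⟨y * (openRep F n)⁻¹, ?_⟩, h, ?_⟩
  · change (y.1 * Matrix.fromBlocks 1 0 (-1) 1).toBlocks₂₁ = 0
    rw [(toBlocks_mul _ _).2.2.1, hy'.1, hy'.2]
    simp
  · change x = y * (openRep F n)⁻¹ * openRep F n * blockDiag n h
    rw [inv_mul_cancel_right, hy, map_inv, inv_mul_cancel_right]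

variable {m : ℕ} (e : Fin m ⊕ Fin m ≃ Fin n)

/-- A block matrix with respect to a decomposition of the set of indices. -/
def halfBlocks (A B C D : Matrix (Fin m) (Fin m) F) : Matrix (Fin n) (Fin n) F :=
  Matrix.reindexAlgEquiv F F e (Matrix.fromBlocks A B C D)

theorem halfBlocks_mul (A B C D A' B' C' D' : Matrix (Fin m) (Fin m) F) :
    halfBlocks e A B C D * halfBlocks e A' B' C' D' =
      halfBlocks e (A * A' + B * C') (A * B' + B * D') (C * A' + D * C') (C * B' + D * D') := by
  rw [halfBlocks, halfBlocks, ← map_mul, Matrix.fromBlocks_multiply, halfBlocks]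

theorem halfBlocks_add (A B C D A' B' C' D' : Matrix (Fin m) (Fin m) F) :
    halfBlocks e A B C D + halfBlocks e A' B' C' D' =
      halfBlocks e (A + A') (B + B') (C + C') (D + D') := by
  rw [halfBlocks, halfBlocks, ← map_add, Matrix.fromBlocks_add, halfBlocks]

theorem halfBlocks_one : halfBlocks e (1 : Matrix (Fin m) (Fin m) F) 0 0 1 = 1 := by
  rw [halfBlocks, Matrix.fromBlocks_one, map_one]

theorem halfBlocks_zero : halfBlocks e (0 : Matrix (Fin m) (Fin m) F) 0 0 0 = 0 := by
  rw [halfBlocks, Matrix.fromBlocks_zero, map_zero]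

theorem halfBlocks_injective {A B C D A' B' C' D' : Matrix (Fin m) (Fin m) F}
    (h : halfBlocks e A B C D = halfBlocks e A' B' C' D') :
    A = A' ∧ B = B' ∧ C = C' ∧ D = D' :=
  Matrix.fromBlocks_inj.1 ((Matrix.reindexAlgEquiv F F e).injective h)

theorem exists_eq_halfBlocks (X : Matrix (Fin n) (Fin n) F) :
    ∃ A B C D, X = halfBlocks e A B C D := by
  set Y := (Matrix.reindexAlgEquiv F F e).symm X with hY
  refine ⟨Y.toBlocks₁₁, Y.toBlocks₁₂, Y.toBlocks₂₁, Y.toBlocks₂₂, ?_⟩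
  rw [halfBlocks, Matrix.fromBlocks_toBlocks, hY, AlgEquiv.apply_symm_apply]

theorem det_halfBlocks (A B D : Matrix (Fin m) (Fin m) F) :
    (halfBlocks e A B 0 D).det = A.det * D.det := by
  rw [halfBlocks, Matrix.det_reindexAlgEquiv, Matrix.det_fromBlocks_zero₂₁]

/-- A representative of the double coset of the subspaces of dimension `n` of `F^n × F^n` which are
the sum of their intersections, of dimension `m`, with the two factors. -/
def closedRep : GL (Fin n ⊕ Fin n) F where
  val := Matrix.fromBlocks (halfBlocks e 1 0 0 0) (halfBlocks e 0 0 1 0)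
    (halfBlocks e 0 1 0 0) (halfBlocks e 0 0 0 1)
  inv := Matrix.fromBlocks (halfBlocks e 1 0 0 0) (halfBlocks e 0 0 1 0)
    (halfBlocks e 0 1 0 0) (halfBlocks e 0 0 0 1)
  val_inv := by
    simp [Matrix.fromBlocks_multiply, halfBlocks_mul, halfBlocks_add, halfBlocks_one,
      halfBlocks_zero]
  inv_val := by
    simp [Matrix.fromBlocks_multiply, halfBlocks_mul, halfBlocks_add, halfBlocks_one,
      halfBlocks_zero]

theorem closedRep_val : (closedRep e : GL (Fin n ⊕ Fin n) F).1 =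
    Matrix.fromBlocks (halfBlocks e 1 0 0 0) (halfBlocks e 0 0 1 0)
      (halfBlocks e 0 1 0 0) (halfBlocks e 0 0 0 1) := rfl

theorem closedRep_inv : (closedRep e : GL (Fin n ⊕ Fin n) F)⁻¹ = closedRep e := rfl

theorem mul_halfBlocks_eq_zero {X : Matrix (Fin n) (Fin n) F}
    (h : ∀ k i, X k (e (Sum.inl i)) = 0) : X * halfBlocks e 1 0 0 0 = 0 := by
  ext k l
  rw [Matrix.mul_apply, ← e.sum_comp, Fintype.sum_sum_type]
  obtain ⟨t, rfl⟩ := e.surjective l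
  simp only [h, zero_mul, Finset.sum_const_zero, zero_add]
  refine Finset.sum_eq_zero fun i _ => ?_
  have : (halfBlocks e (1 : Matrix (Fin m) (Fin m) F) 0 0 0) (e (Sum.inr i)) (e t) = 0 := by
    cases t <;> simp [halfBlocks]
  rw [this, mul_zero]

theorem exists_mul_halfBlocks_eq_zero (hn : n = 2 * m) (X : Matrix (Fin n) (Fin n) F)
    (hX : Module.finrank F (LinearMap.ker X.mulVecLin) = m) :
    ∃ h : GL (Fin n) F, X * h.1 * halfBlocks e 1 0 0 0 = 0 := by
  obtain ⟨C, hC⟩ := Submodule.exists_isCompl (LinearMap.ker X.mulVecLin)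
  have hCdim : Module.finrank F C = m := by
    have := Submodule.finrank_add_eq_of_isCompl hC
    rw [hX, Module.finrank_fin_fun] at this
    omega
  let b : Module.Basis (Fin n) F (Fin n → F) :=
    (((Module.finBasisOfFinrankEq F _ hX).prod (Module.finBasisOfFinrankEq F _ hCdim)).map
      (Submodule.prodEquivOfIsCompl _ _ hC)).reindex e
  have hb : ∀ i, X *ᵥ b (e (Sum.inl i)) = 0 := by
    intro i
    have : b (e (Sum.inl i)) = (Module.finBasisOfFinrankEq F _ hX i).1 := by
      simp [b]
    rw [this]
    exact (Module.finBasisOfFinrankEq F _ hX i).2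
  let φ := b.equivFun.symm
  refine ⟨⟨LinearMap.toMatrix' φ.toLinearMap, LinearMap.toMatrix' φ.symm.toLinearMap, ?_, ?_⟩, ?_⟩
  · rw [← LinearMap.toMatrix'_comp, LinearEquiv.comp_coe, LinearEquiv.symm_trans_self,
      LinearEquiv.refl_toLinearMap, LinearMap.toMatrix'_id]
  · rw [← LinearMap.toMatrix'_comp, LinearEquiv.comp_coe, LinearEquiv.self_trans_symm,
      LinearEquiv.refl_toLinearMap, LinearMap.toMatrix'_id]
  · refine mul_halfBlocks_eq_zero e fun k i => ?_
    have h1 := congrFun (hb i) k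
    have h2 : φ (Pi.single (e (Sum.inl i)) 1) = b (e (Sum.inl i)) := by
      simp [φ]
    rw [← h2] at h1
    have h3 : φ (Pi.single (e (Sum.inl i)) 1) =
        LinearMap.toMatrix' φ.toLinearMap *ᵥ Pi.single (e (Sum.inl i)) 1 := by
      rw [LinearMap.toMatrix'_mulVec]
      rfl
    rw [h3, Matrix.mulVec_mulVec, Matrix.mulVec_single_one] at h1
    exact h1

theorem exists_eq_mul_closedRep (hn : n = 2 * m) (x : GL (Fin n ⊕ Fin n) F)
    (h₁ : Module.finrank F (LinearMap.ker x.1.toBlocks₂₁.mulVecLin) = m)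
    (h₂ : Module.finrank F (LinearMap.ker x.1.toBlocks₂₂.mulVecLin) = m) :
    ∃ (p : parabolic F n) (h : GL (Fin n) F × GL (Fin n) F),
      x = p.1 * closedRep e * blockDiag n h := by
  obtain ⟨a, ha⟩ := exists_mul_halfBlocks_eq_zero e hn _ h₁
  obtain ⟨b, hb⟩ := exists_mul_halfBlocks_eq_zero e hn _ h₂
  refine ⟨⟨x * blockDiag n (a, b) * (closedRep e)⁻¹, ?_⟩, (a, b)⁻¹, ?_⟩
  · change (x.1 * (blockDiag n (a, b)).1 * (closedRep e).1).toBlocks₂₁ = 0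
    have h3 := toBlocks_mul x.1 (blockDiag n (a, b)).1
    rw [blockDiag_val] at h3 ⊢
    simp only [Matrix.toBlocks_fromBlocks₁₁, Matrix.toBlocks_fromBlocks₁₂,
      Matrix.toBlocks_fromBlocks₂₁, Matrix.toBlocks_fromBlocks₂₂, mul_zero, add_zero,
      zero_add] at h3
    have h4 : halfBlocks e (0 : Matrix (Fin m) (Fin m) F) 1 0 0 =
        halfBlocks e 1 0 0 0 * halfBlocks e 0 1 0 0 := by
      simp [halfBlocks_mul]
    rw [(toBlocks_mul _ _).2.2.1, h3.2.2.1, h3.2.2.2, closedRep_val,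
      Matrix.toBlocks_fromBlocks₁₁, Matrix.toBlocks_fromBlocks₂₁, ha, h4, ← mul_assoc, hb,
      zero_mul, add_zero]
  · change x = x * blockDiag n (a, b) * (closedRep e)⁻¹ * closedRep e * blockDiag n (a, b)⁻¹
    rw [inv_mul_cancel_right, map_inv, mul_inv_cancel_right]

theorem closedRep_conj (A B C D A' B' C' D' : Matrix (Fin m) (Fin m) F) :
    (closedRep e).1 * Matrix.fromBlocks (halfBlocks e A B C D) 0 0 (halfBlocks e A' B' C' D') *
      (closedRep e).1 = Matrix.fromBlocks (halfBlocks e A 0 0 A') (halfBlocks e B 0 0 B')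
        (halfBlocks e C 0 0 C') (halfBlocks e D 0 0 D') := by
  rw [closedRep_val, Matrix.fromBlocks_multiply, Matrix.fromBlocks_multiply]
  simp [halfBlocks_mul, halfBlocks_add]

theorem openRep_ne_closedRep (hm : 0 < m) (p : parabolic F n) (h : GL (Fin n) F × GL (Fin n) F) :
    p.1 * openRep F n ≠ closedRep e * blockDiag n h := by
  intro heq
  have h1 : p.1.1 * (Matrix.fromBlocks 1 0 1 1) =
      (closedRep e).1 * Matrix.fromBlocks h.1.1 0 0 h.2.1 := congrArg Units.val heq
  have h2 := congrArg Matrix.toBlocks₂₁ h1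
  have h3 := congrArg Matrix.toBlocks₂₂ h1
  rw [(toBlocks_mul _ _).2.2.1, (toBlocks_mul _ _).2.2.1] at h2
  rw [(toBlocks_mul _ _).2.2.2, (toBlocks_mul _ _).2.2.2] at h3
  have hp : p.1.1.toBlocks₂₁ = 0 := p.2
  simp only [closedRep_val, hp, Matrix.toBlocks_fromBlocks₁₁, Matrix.toBlocks_fromBlocks₁₂,
    Matrix.toBlocks_fromBlocks₂₁, Matrix.toBlocks_fromBlocks₂₂, mul_zero, add_zero, zero_add,
    mul_one] at h2 h3
  have h4 := congrArg (fun M => M * (h.1⁻¹).1 * halfBlocks e 0 0 1 0) (h2.symm.trans h3)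
  have hinv : h.1.1 * (h.1⁻¹).1 = 1 := by rw [← Units.val_mul, mul_inv_cancel, Units.val_one]
  have h5 := congrArg (fun M => halfBlocks e 1 0 0 0 * M) h4
  simp only [mul_assoc] at h5
  rw [← mul_assoc h.1.1, hinv, one_mul] at h5
  simp only [← mul_assoc, halfBlocks_mul] at h5
  simp only [mul_zero, zero_mul, mul_one, add_zero, zero_add, halfBlocks_zero] at h5
  rw [← halfBlocks_zero e] at h5
  have h6 := congrFun (congrFun (halfBlocks_injective e h5).1 ⟨0, hm⟩) ⟨0, hm⟩
  simp at h6

end Representatives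

section Contributions

variable {F : Type*} [Field F] {n : ℕ} {V₁ V₂ : Type*} [AddCommGroup V₁] [Module ℂ V₁]
  [AddCommGroup V₂] [Module ℂ V₂] (π₁ : Representation ℂ (GL (Fin n) F) V₁)
  (π₂ : Representation ℂ (GL (Fin n) F) V₂) (χ₁ χ₂ : Fˣ →* ℂˣ)

/-- The contribution of the double coset of `s` to the eigenvectors in `π₁ × π₂`. -/
noncomputable abbrev cosetSpace (s : GL (Fin n ⊕ Fin n) F) :
    Submodule ℂ (TensorProduct ℂ V₁ V₂) :=
  mackeySpace (parabolic F n).subtype (inflation π₁ π₂) (blockDiag n) (pairChar n χ₁ χ₂) s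

variable {π₁ π₂ χ₁ χ₂}

theorem mem_cosetSpace_openRep {v : TensorProduct ℂ V₁ V₂} :
    v ∈ cosetSpace π₁ π₂ χ₁ χ₂ (openRep F n) ↔ ∀ g : GL (Fin n) F,
      TensorProduct.map (π₁ g) (π₂ g) v = (pairChar n χ₁ χ₂ (g, g) : ℂ) • v := by
  constructor
  · intro hv g
    have hp : (blockDiag n (g, g)).1.toBlocks₂₁ = 0 := by
      rw [blockDiag_val, Matrix.toBlocks_fromBlocks₂₁]
    rw [← hv ⟨blockDiag n (g, g), hp⟩ (g, g) ?_]
    · rw [inflation_apply _ g g]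
      · exact Matrix.toBlocks_fromBlocks₁₁ _ _ _ _
      · exact Matrix.toBlocks_fromBlocks₂₂ _ _ _ _
    · ext1
      change Matrix.fromBlocks g.1 0 0 g.1 * Matrix.fromBlocks 1 0 1 1 =
        Matrix.fromBlocks 1 0 1 1 * Matrix.fromBlocks g.1 0 0 g.1
      simp [Matrix.fromBlocks_multiply]
  · intro hv p h heq
    have h1 : p.1.1 * (Matrix.fromBlocks 1 0 1 1) =
        Matrix.fromBlocks 1 0 1 1 * Matrix.fromBlocks h.1.1 0 0 h.2.1 := congrArg Units.val heq
    have hp : p.1.1.toBlocks₂₁ = 0 := p.2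
    have e₁ := congrArg Matrix.toBlocks₁₁ h1
    have e₂ := congrArg Matrix.toBlocks₁₂ h1
    have e₃ := congrArg Matrix.toBlocks₂₁ h1
    have e₄ := congrArg Matrix.toBlocks₂₂ h1
    rw [(toBlocks_mul _ _).1, (toBlocks_mul _ _).1] at e₁
    rw [(toBlocks_mul _ _).2.1, (toBlocks_mul _ _).2.1] at e₂
    rw [(toBlocks_mul _ _).2.2.1, (toBlocks_mul _ _).2.2.1] at e₃
    rw [(toBlocks_mul _ _).2.2.2, (toBlocks_mul _ _).2.2.2] at e₄
    simp only [hp, Matrix.toBlocks_fromBlocks₁₁, Matrix.toBlocks_fromBlocks₁₂,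
      Matrix.toBlocks_fromBlocks₂₁, Matrix.toBlocks_fromBlocks₂₂, mul_zero, add_zero, zero_add,
      mul_one, one_mul, zero_mul] at e₁ e₂ e₃ e₄
    rw [e₂, add_zero] at e₁
    have h12 : h.1 = h.2 := Units.ext (e₃.symm.trans e₄)
    rw [inflation_apply p h.1 h.1 e₁ e₃, hv h.1]
    conv_lhs => rw [show (h.1, h.1) = h from Prod.ext rfl h12]

theorem map_twist (g : GL (Fin n) F) (v : TensorProduct ℂ V₁ V₂) :
    TensorProduct.map (twist π₁ (detChar n χ₁⁻¹) g) (twist π₂ (detChar n χ₂⁻¹) g) v = v ↔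
      TensorProduct.map (π₁ g) (π₂ g) v = (pairChar n χ₁ χ₂ (g, g) : ℂ) • v := by
  have h : TensorProduct.map (twist π₁ (detChar n χ₁⁻¹) g) (twist π₂ (detChar n χ₂⁻¹) g) v =
      (((pairChar n χ₁ χ₂ (g, g))⁻¹ : ℂˣ) : ℂ) • TensorProduct.map (π₁ g) (π₂ g) v := by
    have h1 : twist π₁ (detChar n χ₁⁻¹) g =
      (((χ₁ (Matrix.GeneralLinearGroup.det g))⁻¹ : ℂˣ) : ℂ) • π₁ g := rfl
    have h2 : twist π₂ (detChar n χ₂⁻¹) g =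
      (((χ₂ (Matrix.GeneralLinearGroup.det g))⁻¹ : ℂˣ) : ℂ) • π₂ g := rfl
    rw [h1, h2, TensorProduct.map_smul_left, TensorProduct.map_smul_right, smul_smul,
      pairChar_apply, mul_inv, Units.val_mul]
    rfl
  rw [h, ← Units.smul_def, ← Units.smul_def, inv_smul_eq_iff]

theorem map_inv_eq_iff {G : Type*} [Group G] (τ₁ : Representation ℂ G V₁)
    (τ₂ : Representation ℂ G V₂) (g : G) (v : TensorProduct ℂ V₁ V₂) :
    TensorProduct.map (τ₁ g⁻¹) LinearMap.id v = TensorProduct.map LinearMap.id (τ₂ g) v ↔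
      TensorProduct.map (τ₁ g) (τ₂ g) v = v := by
  have h1 : τ₁ g⁻¹ ∘ₗ τ₁ g = LinearMap.id := by
    rw [← Module.End.mul_eq_comp, ← map_mul, inv_mul_cancel, map_one, Module.End.one_eq_id]
  have h2 : τ₁ g ∘ₗ τ₁ g⁻¹ = LinearMap.id := by
    rw [← Module.End.mul_eq_comp, ← map_mul, mul_inv_cancel, map_one, Module.End.one_eq_id]
  constructor
  · intro h
    have h3 := congrArg (TensorProduct.map (τ₁ g) LinearMap.id) h
    rw [← LinearMap.comp_apply, ← LinearMap.comp_apply, ← TensorProduct.map_comp,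
      ← TensorProduct.map_comp, h2, LinearMap.comp_id, LinearMap.comp_id, LinearMap.id_comp,
      TensorProduct.map_id] at h3
    exact h3.symm
  · intro h
    have h3 := congrArg (TensorProduct.map (τ₁ g⁻¹) LinearMap.id) h
    rw [← LinearMap.comp_apply, ← TensorProduct.map_comp, h1, LinearMap.id_comp] at h3
    exact h3.symm

theorem contractHom_comp_dual_iff {G : Type*} [Group G] (τ₁ : Representation ℂ G V₁)
    (τ₂ : Representation ℂ G V₂) (g : G) (v : TensorProduct ℂ V₁ V₂) :
    contractHom V₁ V₂ v ∘ₗ τ₁.dual g = τ₂ g ∘ₗ contractHom V₁ V₂ v ↔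
      TensorProduct.map (τ₁ g) (τ₂ g) v = v := by
  rw [← map_inv_eq_iff]
  have h1 : ∀ φ, (contractHom V₁ V₂ v ∘ₗ τ₁.dual g) φ =
      contractHom V₁ V₂ (TensorProduct.map (τ₁ g⁻¹) LinearMap.id v) φ := by
    intro φ
    rw [contractHom_apply, contract_map]
    rfl
  have h2 : ∀ φ, (τ₂ g ∘ₗ contractHom V₁ V₂ v) φ =
      contractHom V₁ V₂ (TensorProduct.map LinearMap.id (τ₂ g) v) φ := by
    intro φ
    rw [contractHom_apply, contract_map]
    rfl
  rw [LinearMap.ext h1, LinearMap.ext h2]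
  exact contractHom_injective.eq_iff

variable (π₁ π₂ χ₁ χ₂) in
/-- The contribution of the open double coset is a space of intertwining maps. -/
noncomputable def cosetSpaceOpenRepEquiv [FiniteDimensional ℂ V₁] [FiniteDimensional ℂ V₂] :
    cosetSpace π₁ π₂ χ₁ χ₂ (openRep F n) ≃ₗ[ℂ] Representation.IntertwiningMap
      (Representation.dual (twist π₁ (detChar n χ₁⁻¹))) (twist π₂ (detChar n χ₂⁻¹)) where
  toFun v := ⟨contractHom V₁ V₂ v.1, fun g => (contractHom_comp_dual_iff _ _ _ _).2
    ((map_twist _ _).2 (mem_cosetSpace_openRep.1 v.2 g))⟩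
  map_add' v w := by
    ext φ
    exact map_add (contract φ) v.1 w.1
  map_smul' c v := by
    ext φ
    exact map_smul (contract φ) c v.1
  invFun f := ⟨(contractEquiv V₁ V₂).symm f.toLinearMap, mem_cosetSpace_openRep.2 fun g => by
    refine (map_twist _ _).1 ((contractHom_comp_dual_iff _ _ _ _).1 ?_)
    have : contractHom V₁ V₂ ((contractEquiv V₁ V₂).symm f.toLinearMap) = f.toLinearMap :=
      (contractEquiv V₁ V₂).apply_symm_apply f.toLinearMap
    rw [this]
    exact f.isIntertwining' g⟩
  left_inv v := Subtype.ext ((contractEquiv V₁ V₂).symm_apply_apply v.1)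
  right_inv f := Representation.IntertwiningMap.ext
    ((contractEquiv V₁ V₂).apply_symm_apply f.toLinearMap)

theorem finrank_cosetSpace_openRep [FiniteDimensional ℂ V₁] [FiniteDimensional ℂ V₂]
    (h₁ : π₁.IsIrreducible) (h₂ : π₂.IsIrreducible) :
    Module.finrank ℂ (cosetSpace π₁ π₂ χ₁ χ₂ (openRep F n)) =
      iverson (DualTwist π₁ π₂ χ₁ χ₂) := by
  rw [(cosetSpaceOpenRepEquiv π₁ π₂ χ₁ χ₂).finrank_eq]
  exact finrank_intertwiningMap_eq_iverson (isIrreducible_dual (isIrreducible_twist h₁ _))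
    (isIrreducible_twist h₂ _)

variable {m : ℕ} (hnm : n = 2 * m)

/-- The decomposition of `n = 2m` indices underlying `blockDiagHalf`. -/
def halfEquiv : Fin m ⊕ Fin m ≃ Fin n :=
  finSumFinEquiv.trans (finCongr (by omega))

theorem blockDiagHalf_val (k : GL (Fin m) F × GL (Fin m) F) :
    (blockDiagHalf hnm k).1 = halfBlocks (halfEquiv hnm) k.1.1 0 0 k.2.1 := rfl

theorem det_blockDiagHalf (k : GL (Fin m) F × GL (Fin m) F) :
    Matrix.GeneralLinearGroup.det (blockDiagHalf hnm k) =
      Matrix.GeneralLinearGroup.det k.1 * Matrix.GeneralLinearGroup.det k.2 :=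
  Units.ext (det_halfBlocks (halfEquiv hnm) k.1.1 0 k.2.1)

theorem cosetSpace_closedRep [Fintype (GL (Fin m) F × GL (Fin m) F)] :
    cosetSpace π₁ π₂ χ₁ χ₂ (closedRep (halfEquiv hnm)) =
      tensorEigenvectors (π₁.comp (blockDiagHalf hnm)) (pairChar m χ₁ χ₂)
        (π₂.comp (blockDiagHalf hnm)) (pairChar m χ₁ χ₂) := by
  set e := halfEquiv hnm with he
  refine le_antisymm ?_ ?_
  · intro v hv k k'
    set h : GL (Fin n) F × GL (Fin n) F :=
      (blockDiagHalf hnm (k.1, k'.1), blockDiagHalf hnm (k.2, k'.2)) with hh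
    have hconj : (closedRep e * blockDiag n h * (closedRep e)⁻¹).1 =
        Matrix.fromBlocks (blockDiagHalf hnm k).1 0 0 (blockDiagHalf hnm k').1 := by
      rw [closedRep_inv]
      change (closedRep e).1 * Matrix.fromBlocks (halfBlocks e k.1.1 0 0 k'.1.1) 0 0
        (halfBlocks e k.2.1 0 0 k'.2.1) * (closedRep e).1 = _
      rw [closedRep_conj, blockDiagHalf_val, blockDiagHalf_val, halfBlocks_zero]
    have hp : (closedRep e * blockDiag n h * (closedRep e)⁻¹) ∈ parabolic F n := by
      change (closedRep e * blockDiag n h * (closedRep e)⁻¹).1.toBlocks₂₁ = 0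
      rw [hconj, Matrix.toBlocks_fromBlocks₂₁]
    have h1 := hv ⟨_, hp⟩ h (inv_mul_cancel_right _ _)
    rw [inflation_apply _ (blockDiagHalf hnm k) (blockDiagHalf hnm k')] at h1
    · refine h1.trans ?_
      congr 1
      simp only [pairChar_apply, hh, det_blockDiagHalf, map_mul, Units.val_mul]
      ring
    · change (closedRep e * blockDiag n h * (closedRep e)⁻¹).1.toBlocks₁₁ = _
      rw [hconj, Matrix.toBlocks_fromBlocks₁₁]
    · change (closedRep e * blockDiag n h * (closedRep e)⁻¹).1.toBlocks₂₂ = _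
      rw [hconj, Matrix.toBlocks_fromBlocks₂₂]
  · intro v hv p h heq
    obtain ⟨A, B, C, D, hA⟩ := exists_eq_halfBlocks e h.1.1
    obtain ⟨A', B', C', D', hA'⟩ := exists_eq_halfBlocks e h.2.1
    have hpv : p.1.1 = Matrix.fromBlocks (halfBlocks e A 0 0 A') (halfBlocks e B 0 0 B')
        (halfBlocks e C 0 0 C') (halfBlocks e D 0 0 D') := by
      rw [← closedRep_conj, ← hA, ← hA', ← blockDiag_val]
      have : p.1 = closedRep e * blockDiag n h * closedRep e := by
        rw [← heq]
        exact (mul_inv_cancel_right _ _).symm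
      rw [this]
      rfl
    have hp : p.1.1.toBlocks₂₁ = 0 := p.2
    rw [hpv, Matrix.toBlocks_fromBlocks₂₁, ← halfBlocks_zero e] at hp
    obtain ⟨rfl, -, -, rfl⟩ := halfBlocks_injective e hp
    have hd₁ : A.det * D.det = (Matrix.GeneralLinearGroup.det h.1).1 := by
      rw [← det_halfBlocks e A B D, ← hA]
      rfl
    have hd₂ : A'.det * D'.det = (Matrix.GeneralLinearGroup.det h.2).1 := by
      rw [← det_halfBlocks e A' B' D', ← hA']
      rfl
    have hne₁ : A.det * D.det ≠ 0 := hd₁ ▸ Units.ne_zero _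
    have hne₂ : A'.det * D'.det ≠ 0 := hd₂ ▸ Units.ne_zero _
    set a := Matrix.GeneralLinearGroup.mkOfDetNeZero A (left_ne_zero_of_mul hne₁)
    set d := Matrix.GeneralLinearGroup.mkOfDetNeZero D (right_ne_zero_of_mul hne₁)
    set a' := Matrix.GeneralLinearGroup.mkOfDetNeZero A' (left_ne_zero_of_mul hne₂)
    set d' := Matrix.GeneralLinearGroup.mkOfDetNeZero D' (right_ne_zero_of_mul hne₂)
    have hu₁ : Matrix.GeneralLinearGroup.det h.1 =
        Matrix.GeneralLinearGroup.det a * Matrix.GeneralLinearGroup.det d := Units.ext hd₁.symm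
    have hu₂ : Matrix.GeneralLinearGroup.det h.2 =
        Matrix.GeneralLinearGroup.det a' * Matrix.GeneralLinearGroup.det d' := Units.ext hd₂.symm
    rw [inflation_apply p (blockDiagHalf hnm (a, a')) (blockDiagHalf hnm (d, d'))]
    · refine (hv (a, a') (d, d')).trans ?_
      congr 1
      simp only [pairChar_apply, hu₁, hu₂, map_mul, Units.val_mul]
      ring
    · rw [hpv, Matrix.toBlocks_fromBlocks₁₁]
      rfl
    · rw [hpv, Matrix.toBlocks_fromBlocks₂₂]
      rfl

theorem finrank_cosetSpace_closedRep [Finite F] :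
    Module.finrank ℂ (cosetSpace π₁ π₂ χ₁ χ₂ (closedRep (halfEquiv hnm))) =
      halfMult hnm π₁ χ₁ χ₂ * halfMult hnm π₂ χ₁ χ₂ := by
  have := Fintype.ofFinite (GL (Fin m) F × GL (Fin m) F)
  rw [cosetSpace_closedRep, finrank_tensorEigenvectors, halfMult, halfMult,
    mult_eq_finrank_eigenvectors, mult_eq_finrank_eigenvectors]

end Contributions

section Support

variable {F : Type*} [Field F] {n : ℕ} {V₁ V₂ : Type*} [AddCommGroup V₁] [Module ℂ V₁]
  [AddCommGroup V₂] [Module ℂ V₂] {π₁ : Representation ℂ (GL (Fin n) F) V₁}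
  {π₂ : Representation ℂ (GL (Fin n) F) V₂} {χ₁ χ₂ : Fˣ →* ℂˣ}

theorem finrank_fixedSpace_add {E : Matrix (Fin n) (Fin n) F} (hE : E * E = E) :
    Module.finrank F (fixedSpace E) + Module.finrank F (fixedSpace (1 - E)) = n := by
  have h₁ : fixedSpace E = LinearMap.range E.mulVecLin := by
    ext x
    constructor
    · exact fun hx => ⟨x, hx⟩
    · rintro ⟨y, rfl⟩
      change E *ᵥ (E *ᵥ y) = E *ᵥ y
      rw [Matrix.mulVec_mulVec, hE]
  have h₂ : fixedSpace (1 - E) = LinearMap.ker E.mulVecLin := by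
    ext x
    rw [mem_fixedSpace, Matrix.sub_mulVec, Matrix.one_mulVec, sub_eq_self, LinearMap.mem_ker,
      Matrix.mulVecLin_apply]
  rw [h₁, h₂, LinearMap.finrank_range_add_finrank_ker, Module.finrank_fin_fun]

theorem finrank_ker_add_finrank_fixedSpace {X Y : Matrix (Fin n) (Fin n) F} (h : X * Y * X = X) :
    Module.finrank F (LinearMap.ker X.mulVecLin) + Module.finrank F (fixedSpace (X * Y)) = n := by
  have h₁ : fixedSpace (X * Y) = LinearMap.range X.mulVecLin := by
    ext x
    constructor
    · intro hx
      refine ⟨Y *ᵥ x, ?_⟩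
      rw [Matrix.mulVecLin_apply, Matrix.mulVec_mulVec]
      exact hx
    · rintro ⟨y, rfl⟩
      change (X * Y) *ᵥ (X *ᵥ y) = X *ᵥ y
      rw [Matrix.mulVec_mulVec, h]
  rw [h₁, add_comm, LinearMap.finrank_range_add_finrank_ker, Module.finrank_fin_fun]

theorem det_ne_zero_of_range_mulVecLin {A B : Matrix (Fin n) (Fin n) F}
    (h : LinearMap.range (A * B).mulVecLin = ⊤) : A.det ≠ 0 := by
  have h1 : IsUnit (A * B) := by
    rw [← Matrix.mulVec_surjective_iff_isUnit]
    exact LinearMap.range_eq_top.1 h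
  have h2 := (Matrix.isUnit_iff_isUnit_det _).1 h1
  rw [Matrix.det_mul] at h2
  exact left_ne_zero_of_mul h2.ne_zero

/-- Eigenvectors in `π₁ × π₂` are supported on the open double coset and, if `n` is even, on the
double coset of `closedRep`. -/
theorem support_indEigenvectors [Finite F] (hn : 2 ≤ n) (hπ₂ : IsCuspidal π₂)
    (f : indEigenvectors π₁ π₂ χ₁ χ₂) (x : GL (Fin n ⊕ Fin n) F) (hf : f.1.1 x ≠ 0) :
    (∃ (p : parabolic F n) (h : GL (Fin n) F × GL (Fin n) F),
      x = p.1 * openRep F n * blockDiag n h) ∨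
    ∃ (m : ℕ) (hnm : n = 2 * m) (p : parabolic F n) (h : GL (Fin n) F × GL (Fin n) F),
      x = p.1 * closedRep (halfEquiv hnm) * blockDiag n h := by
  by_cases htop : LinearMap.range (x.1.toBlocks₂₁ * (x⁻¹).1.toBlocks₁₁).mulVecLin = ⊤
  · left
    refine exists_eq_mul_openRep x (det_ne_zero_of_range_mulVecLin htop)
      (det_ne_zero_of_range_mulVecLin (B := -(x⁻¹).1.toBlocks₂₁) ?_)
    rwa [mul_neg, ← eq_neg_of_add_eq_zero_left (mul_inv_toBlocks x).1]
  right
  have hbot : LinearMap.range (x.1.toBlocks₂₁ * (x⁻¹).1.toBlocks₁₁).mulVecLin = ⊥ := by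
    by_contra hbot
    exact hf (apply_eq_zero_of_range_ne hπ₂ f x hbot htop)
  have hZ : x.1.toBlocks₂₁ * (x⁻¹).1.toBlocks₁₁ = 0 := by
    refine Matrix.ext_of_mulVec_single fun i => ?_
    rw [Matrix.zero_mulVec, ← Matrix.mulVecLin_apply, LinearMap.range_eq_bot.1 hbot]
    rfl
  have heq := finrank_fixedSpace_blocks_eq hn hπ₂ f x hZ hf
  obtain ⟨h1, -, -, h4⟩ := blocks_idempotent x hZ
  have hk₁ := finrank_ker_add_finrank_fixedSpace h1
  have hk₂ := finrank_ker_add_finrank_fixedSpace h4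
  have hsum := finrank_fixedSpace_add (E := x.1.toBlocks₂₁ * (x⁻¹).1.toBlocks₁₂)
    (by rw [← mul_assoc, h1])
  rw [← eq_sub_of_add_eq' (mul_inv_toBlocks x).2] at hsum
  refine ⟨Module.finrank F (fixedSpace (x.1.toBlocks₂₁ * (x⁻¹).1.toBlocks₁₂)), by omega, ?_⟩
  exact exists_eq_mul_closedRep _ (by omega) x (by omega) (by omega)

theorem finrank_indEigenvectors_of_even [Finite F] [FiniteDimensional ℂ V₁]
    [FiniteDimensional ℂ V₂] (hn : 2 ≤ n) (hπ₁ : IsCuspidal π₁) (hπ₂ : IsCuspidal π₂) {m : ℕ}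
    (hnm : n = 2 * m) :
    Module.finrank ℂ (indEigenvectors π₁ π₂ χ₁ χ₂) = iverson (DualTwist π₁ π₂ χ₁ χ₂) +
      halfMult hnm π₁ χ₁ χ₂ * halfMult hnm π₂ χ₁ χ₂ := by
  let s : Bool → GL (Fin n ⊕ Fin n) F := fun b =>
    bif b then openRep F n else closedRep (halfEquiv hnm)
  have hm : 0 < m := by omega
  have hinj : Function.Injective (mackeyEval (parabolic F n).subtype (inflation π₁ π₂)
      (blockDiag n) (pairChar n χ₁ χ₂) s) := by
    refine mackeyEval_injective fun f x hf => ?_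
    rcases support_indEigenvectors hn hπ₂ f x hf with ⟨p, h, hx⟩ | ⟨m', hnm', p, h, hx⟩
    · exact ⟨true, p, h, hx⟩
    · obtain rfl : m' = m := by omega
      exact ⟨false, p, h, hx⟩
  have hsurj : Function.Surjective (mackeyEval (parabolic F n).subtype (inflation π₁ π₂)
      (blockDiag n) (pairChar n χ₁ χ₂) s) := by
    refine mackeyEval_surjective fun i i' p h heq => ?_
    cases i <;> cases i'
    · rfl
    · refine absurd ?_ (openRep_ne_closedRep (halfEquiv hnm) hm p⁻¹ h⁻¹)
      change p.1 * closedRep (halfEquiv hnm) = openRep F n * blockDiag n h at heq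
      change p.1⁻¹ * openRep F n = _
      rw [map_inv, eq_mul_inv_iff_mul_eq, mul_assoc, ← heq, inv_mul_cancel_left]
    · exact absurd heq (openRep_ne_closedRep (halfEquiv hnm) hm p h)
    · rfl
  have h := (LinearEquiv.ofBijective _ ⟨hinj, hsurj⟩).finrank_eq
  rw [Module.finrank_pi_fintype, Fintype.sum_bool] at h
  refine h.trans ?_
  rw [← finrank_cosetSpace_openRep hπ₁.irreducible hπ₂.irreducible, ← finrank_cosetSpace_closedRep]
  rfl

theorem openRep_eval_surjective :
    Function.Surjective (mackeyEval (parabolic F n).subtype (inflation π₁ π₂)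
      (blockDiag n) (pairChar n χ₁ χ₂) (fun _ : Unit => openRep F n)) :=
  mackeyEval_surjective fun _ _ _ _ _ => rfl

theorem finrank_indEigenvectors_of_odd [Finite F] [FiniteDimensional ℂ V₁]
    [FiniteDimensional ℂ V₂] (hn : 2 ≤ n) (hπ₁ : IsCuspidal π₁) (hπ₂ : IsCuspidal π₂)
    (hodd : Odd n) :
    Module.finrank ℂ (indEigenvectors π₁ π₂ χ₁ χ₂) = iverson (DualTwist π₁ π₂ χ₁ χ₂) := by
  have hinj : Function.Injective (mackeyEval (parabolic F n).subtype (inflation π₁ π₂)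
      (blockDiag n) (pairChar n χ₁ χ₂) (fun _ : Unit => openRep F n)) := by
    refine mackeyEval_injective fun f x hf => ?_
    rcases support_indEigenvectors hn hπ₂ f x hf with ⟨p, h, hx⟩ | ⟨m, hnm, -⟩
    · exact ⟨(), p, h, hx⟩
    · exact absurd hodd (Nat.not_odd_iff_even.2 ⟨m, by omega⟩)
  have h := (LinearEquiv.ofBijective _ ⟨hinj, openRep_eval_surjective⟩).finrank_eq
  rw [Module.finrank_pi_fintype, Fintype.sum_unique] at h
  exact h.trans (finrank_cosetSpace_openRep hπ₁.irreducible hπ₂.irreducible)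

theorem finiteDimensional_indEigenvectors [Finite F] [FiniteDimensional ℂ V₁]
    [FiniteDimensional ℂ V₂] : FiniteDimensional ℂ (indEigenvectors π₁ π₂ χ₁ χ₂) := by
  have : Finite (GL (Fin n ⊕ Fin n) F) := inferInstance
  infer_instance

theorem exists_ne_zero_iff_finrank_ne_zero {V : Type*} [AddCommGroup V] [Module ℂ V]
    (W : Submodule ℂ V) [FiniteDimensional ℂ W] :
    (∃ v ∈ W, v ≠ 0) ↔ Module.finrank ℂ W ≠ 0 := by
  rw [← Submodule.ne_bot_iff, Ne, Ne, Submodule.finrank_eq_zero]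

theorem iverson_ne_zero_iff {p : Prop} : iverson p ≠ 0 ↔ p := by
  rw [iverson]
  split_ifs with h <;> simp [h]

theorem halfMult_ne_zero_iff [Finite F] {V : Type*} [AddCommGroup V] [Module ℂ V]
    [FiniteDimensional ℂ V] {m : ℕ} (hnm : n = 2 * m) (π : Representation ℂ (GL (Fin n) F) V) :
    halfMult hnm π χ₁ χ₂ ≠ 0 ↔ ∃ v ∈ halfEigenvectors hnm π χ₁ χ₂, v ≠ 0 := by
  have := Fintype.ofFinite (GL (Fin m) F × GL (Fin m) F)
  rw [exists_ne_zero_iff_finrank_ne_zero, halfMult, mult_eq_finrank_eigenvectors, halfEigenvectors]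

theorem dualTwist_iff_exists [Finite F] [FiniteDimensional ℂ V₁] [FiniteDimensional ℂ V₂]
    (hπ₁ : IsCuspidal π₁) (hπ₂ : IsCuspidal π₂) :
    DualTwist π₁ π₂ χ₁ χ₂ ↔ ∃ v ∈ cosetSpace π₁ π₂ χ₁ χ₂ (openRep F n), v ≠ 0 := by
  rw [exists_ne_zero_iff_finrank_ne_zero,
    finrank_cosetSpace_openRep hπ₁.irreducible hπ₂.irreducible, iverson_ne_zero_iff]

theorem exists_indEigenvectors_of_cosetSpace
    (h : ∃ v ∈ cosetSpace π₁ π₂ χ₁ χ₂ (openRep F n), v ≠ 0) :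
    ∃ f ∈ indEigenvectors π₁ π₂ χ₁ χ₂, f ≠ 0 := by
  obtain ⟨v, hv, hv0⟩ := h
  obtain ⟨f, hf⟩ := openRep_eval_surjective (fun _ => ⟨v, hv⟩)
  refine ⟨f.1, f.2, fun h0 => hv0 ?_⟩
  have h1 : f.1.1 (openRep F n) = v := congrArg Subtype.val (congrFun hf ())
  rw [← h1, h0]
  rfl

/-- For `n = 1`, the values of an eigenvector in `π₁ × π₂` at all elements lie in the contribution
of the open double coset, since the scalar matrices are central. -/
theorem apply_mem_cosetSpace_of_one {π₁ : Representation ℂ (GL (Fin 1) F) V₁}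
    {π₂ : Representation ℂ (GL (Fin 1) F) V₂} (f : indEigenvectors π₁ π₂ χ₁ χ₂)
    (x : GL (Fin 1 ⊕ Fin 1) F) : f.1.1 x ∈ cosetSpace π₁ π₂ χ₁ χ₂ (openRep F 1) := by
  rw [mem_cosetSpace_openRep]
  intro g
  have hscalar : (blockDiag 1 (g, g)).1 = Matrix.scalar _ (g.1 0 0) := by
    have : g.1 = Matrix.scalar _ (g.1 0 0) := by
      ext i j
      fin_cases i; fin_cases j
      simp
    rw [blockDiag_val]
    change Matrix.fromBlocks g.1 0 0 g.1 = _
    conv_lhs => rw [this]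
    simp
  have hcomm : blockDiag 1 (g, g) * x = x * blockDiag 1 (g, g) := by
    ext1
    rw [Units.val_mul, Units.val_mul, hscalar]
    exact Matrix.scalar_commute _ (fun _ => Commute.all _ _) _
  rw [← indEigenvectors_blockDiag_apply, ← hcomm]
  refine (indEigenvectors_parabolic_apply f _ x ?_ g g ?_ ?_).symm
  · rw [blockDiag_val, Matrix.toBlocks_fromBlocks₂₁]
  · rw [blockDiag_val, Matrix.toBlocks_fromBlocks₁₁]
  · rw [blockDiag_val, Matrix.toBlocks_fromBlocks₂₂]

theorem exists_indEigenvectors_iff_of_one [Finite F] [FiniteDimensional ℂ V₁]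
    [FiniteDimensional ℂ V₂] {π₁ : Representation ℂ (GL (Fin 1) F) V₁}
    {π₂ : Representation ℂ (GL (Fin 1) F) V₂} (hπ₁ : IsCuspidal π₁) (hπ₂ : IsCuspidal π₂) :
    (∃ v ∈ indEigenvectors π₁ π₂ χ₁ χ₂, v ≠ 0) ↔ DualTwist π₁ π₂ χ₁ χ₂ := by
  rw [dualTwist_iff_exists hπ₁ hπ₂]
  refine ⟨?_, exists_indEigenvectors_of_cosetSpace⟩
  rintro ⟨f, hf, hf0⟩
  obtain ⟨x, hx⟩ : ∃ x, f.1 x ≠ 0 := by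
    by_contra! hcon
    exact hf0 (Subtype.ext (funext hcon))
  exact ⟨_, apply_mem_cosetSpace_of_one ⟨f, hf⟩ x, hx⟩

end Support

end LinearPeriod

theorem proposition3p1 {F : Type*} [Field F] [Finite F] (n : ℕ) (hn : 0 < n)
    {V₁ V₂ : Type*} [AddCommGroup V₁] [Module ℂ V₁] [AddCommGroup V₂] [Module ℂ V₂]
    (π₁ : Representation ℂ (GL (Fin n) F) V₁)
    (π₂ : Representation ℂ (GL (Fin n) F) V₂)
    (hπ₁ : LinearPeriod.IsCuspidal π₁) (hπ₂ : LinearPeriod.IsCuspidal π₂)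
    (χ₁ χ₂ : Fˣ →* ℂˣ) :
    ((∃ v ∈ LinearPeriod.indEigenvectors π₁ π₂ χ₁ χ₂, v ≠ 0) ↔
      (LinearPeriod.DualTwist π₁ π₂ χ₁ χ₂ ∨
        ∃ (m : ℕ) (h : n = 2 * m),
          (∃ v ∈ LinearPeriod.halfEigenvectors h π₁ χ₁ χ₂, v ≠ 0) ∧
          (∃ v ∈ LinearPeriod.halfEigenvectors h π₂ χ₁ χ₂, v ≠ 0))) ∧
    (1 < n →
      (∀ (m : ℕ) (h : n = 2 * m),
        Module.finrank ℂ (LinearPeriod.indEigenvectors π₁ π₂ χ₁ χ₂) =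
          LinearPeriod.iverson (LinearPeriod.DualTwist π₁ π₂ χ₁ χ₂) +
            LinearPeriod.halfMult h π₁ χ₁ χ₂ * LinearPeriod.halfMult h π₂ χ₁ χ₂) ∧
      (Odd n →
        Module.finrank ℂ (LinearPeriod.indEigenvectors π₁ π₂ χ₁ χ₂) =
          LinearPeriod.iverson (LinearPeriod.DualTwist π₁ π₂ χ₁ χ₂))) := by
  have hV₁ := LinearPeriod.finiteDimensional_of_isIrreducible hπ₁.irreducible
  have hV₂ := LinearPeriod.finiteDimensional_of_isIrreducible hπ₂.irreducible
  refine ⟨?_, fun h1 => ⟨fun m h => LinearPeriod.finrank_indEigenvectors_of_even h1 hπ₁ hπ₂ h,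
    fun hodd => LinearPeriod.finrank_indEigenvectors_of_odd h1 hπ₁ hπ₂ hodd⟩⟩
  rcases (show n = 1 ∨ 2 ≤ n by omega) with rfl | h2
  · rw [LinearPeriod.exists_indEigenvectors_iff_of_one hπ₁ hπ₂, iff_self_or]
    rintro ⟨m, h, -⟩
    omega
  have := LinearPeriod.finiteDimensional_indEigenvectors (π₁ := π₁) (π₂ := π₂) (χ₁ := χ₁)
    (χ₂ := χ₂)
  rw [LinearPeriod.exists_ne_zero_iff_finrank_ne_zero]
  rcases Nat.even_or_odd' n with ⟨m, h | h⟩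
  · rw [LinearPeriod.finrank_indEigenvectors_of_even h2 hπ₁ hπ₂ h, Ne, Nat.add_eq_zero_iff,
      not_and_or, Nat.mul_eq_zero, not_or, ← Ne, ← Ne, ← Ne, LinearPeriod.iverson_ne_zero_iff,
      LinearPeriod.halfMult_ne_zero_iff, LinearPeriod.halfMult_ne_zero_iff]
    refine or_congr_right ⟨fun h' => ⟨m, h, h'⟩, ?_⟩
    rintro ⟨m', hm', h'⟩
    obtain rfl : m' = m := by omega
    exact h'
  · rw [LinearPeriod.finrank_indEigenvectors_of_odd h2 hπ₁ hπ₂ ⟨m, h⟩,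
      LinearPeriod.iverson_ne_zero_iff, iff_self_or]
    rintro ⟨m', hm', -⟩
    omega
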